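/- All graphs are finite and simple; $e(G)=|E(G)|$. For disjoint vertex sets $X,Y$ of a graph $G$ let $e_G(X,Y)$ be the number of edges between them and $d_G(X,Y)=e_G(X,Y)/(|X||Y|)$; the pair $(X,Y)$ is $\epsilon$-regular in $G$ if $|d_G(X',Y')-d_G(X,Y)|<\epsilon$ whenever $X'\subseteq X$, $Y'\subseteq Y$, $|X'|\ge\epsilon|X|$, $|Y'|\ge\epsilon|Y|$. $G[X,Y]$ is the bipartite graph of all $G$-edges between $X$ and $Y$. For a subgraph $H$ of $G$, $G-H$ is $G$ with the edges of $H$ deleted; for a vertex set $\Psi$, $G-\Psi$ is $G$ with the vertices of $\Psi$ deleted. *Dense spots.* An $(m,\gamma)$-dense spot in $G$ is a non-empty bipartite subgraph $D=(U,W;F)$ of $G$ (colour classes $U,W$, edge set $F$, vertex set $V(D)=U\cup W$, the two classes being unordered) with $d_D(U,W)>\gamma$ and all degrees in $D$ larger than $m$. $G$ is $(m,\gamma)$-nowhere-dense if it contains no $(m,\gamma)$-dense spot. Given a family $\mathcal D$ of dense spots in $G$, a set $\mathfrak A\subseteq\bigcup_{D\in\mathcal D}V(D)$ is $(\Lambda,\epsilon,\gamma,k)$-avoiding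 with respect to $\mathcal D$ if for every $\bar U\subseteq V(G)$ with $|\bar U|\le\Lambda k$, all but at most $\epsilon k$ vertices $v\in\mathfrak A$ lie in some $D\in\mathcal D$ with $|\bar U\cap V(D)|\le\gamma^2k$. *Bounded decomposition.* $(\mathbf V,\mathcal D,G_{\rm reg},G_{\rm exp},\mathfrak A)$ is a $(k,\Lambda,\gamma,\epsilon,\nu,\rho)$-bounded decomposition of $G$ (with respect to the trivial partition $\{V(G)\}$) if: 1. $\mathbf V$ is a family of disjoint subsets (clusters) of $V(G)$; 2. $G_{\rm reg}$ is a subgraph of $G-G_{\rm exp}$ on the vertex set $\bigcup\mathbf V$; for each $xy\in E(G_{\rm reg})$ there are distinct $C_x\ni x$, $C_y\ni y$ in $\mathbf V$ with $G[C_x,C_y]=G_{\rm reg}[C_x,C_y]$, and $(C_x,C_y)$ is $\epsilon$-regular in $G$ of density at least $\gamma^2$; 3. $\nu k\le|C|=|C'|\le\epsilon k$ for all $C,C'\in\mathbf V$; 4. $\mathcal D$ is a family of edge-disjoint $(\gamma k,\gamma)$-dense spots in $G-G_{\rm exp}$, and for each $(U,W;F)\in\mathcal D$ all edges of $G[U,W]$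 are contained in members of $\mathcal D$; 5. if $G_{\rm reg}$ has an edge between $C_1,C_2\in\mathbf V$, then $C_1\subseteq U$ and $C_2\subseteq W$ for some $(U,W;F)\in\mathcal D$; 6. for each $C\in\mathbf V$ either $C\subseteq V(G_{\rm exp})$ or $C\cap V(G_{\rm exp})=\emptyset$, and for each $(U,W;F)\in\mathcal D$ we have $C\cap U\in\{\emptyset,C\}$ and $C\cap W\in\{\emptyset,C\}$; 7. $G_{\rm exp}$ is a $(\gamma k,\gamma)$-nowhere-dense subgraph of $G$ in which every vertex has degree larger than $\rho k$; 8. $\mathfrak A\subseteq V(G)\setminus\bigcup\mathbf V$ is $(\Lambda,\epsilon,\gamma,k)$-avoiding with respect to $\mathcal D$. *Sparse decomposition.* $(\Psi,\mathbf V,\mathcal D,G_{\rm reg},G_{\rm exp},\mathfrak A)$ is a $(k,\Omega^{**},\Omega^{*},\Lambda,\gamma,\epsilon,\nu,\rho)$-sparse decomposition of $G$ if $\Psi\subseteq V(G)$, every vertex of $\Psi$ has $G$-degree at least $\Omega^{**}k$, every vertex of $V(G)\setminus\Psi$ has degree at most $\Omega^{*}k$ in the graph spanned by the edges of $\bigcup\mathcal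 D$, of $G_{\rm exp}$ and the edges of $G$ incident with $\Psi$, and $(\mathbf V,\mathcal D,G_{\rm reg},G_{\rm exp},\mathfrak A)$ is a $(k,\Lambda,\gamma,\epsilon,\nu,\rho)$-bounded decomposition of $G-\Psi$. It captures the edges of $G_{\rm reg}$, of $G_{\rm exp}$, the edges of $G$ incident with $\Psi$, and the edges of $G$ between $\mathfrak A$ and $\mathfrak A\cup\bigcup\mathbf V$. **Lemma.** For every $\eta\in(0,10]$ and all $\Lambda,\gamma,\epsilon,\rho>0$ there are $\nu>0$ and $k_0\in\mathbb N$ such that for every sequence $(\Omega_j)_{j\ge1}$ of positive numbers with $\Omega_j/\Omega_{j+1}\le\eta^2/100$ for all $j\ge1$ the following holds. Let $G$ be a graph of order $n$ with average degree $k=2e(G)/n>k_0$. Then there are an integer $i$ with $1\le i\le100\eta^{-2}$ and a spanning subgraph $G'$ of $G$ with $e(G)-e(G')<\eta kn$ such that $G'$ has a $(k,\Omega_{i+1},\Omega_i,\Lambda,\gamma,\epsilon,\nu,\rho)$-sparse decomposition $(\Psi,\mathbf V,\mathcal D,G_{\rm reg},G_{\rm exp},\mathfrak A)$ that captures all but at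 most $$\Bigl(\eta+\frac{4\epsilon}{\gamma}+\epsilon\,\Omega_{\lfloor100\eta^{-2}\rfloor}+\gamma+\rho\Bigr)kn$$ edges of $G$. -/

import Mathlib

/-- A triple `(U, W; F)` consisting of two vertex sets and (the edge set of) a graph `F`. -/
structure BipTriple (V : Type*) where
  U : Finset V
  W : Finset V
  F : SimpleGraph V

/-- The vertex set `U ∪ W` of the triple `(U, W; F)`. -/
def BipTriple.verts {V : Type*} (D : BipTriple V) : Set V := {v | v ∈ D.U ∨ v ∈ D.W}

open scoped Classical in
/-- `D = (U, W; F)` is an `(m, γ)`-dense spot in `G`: a non-empty bipartite subgraph of `G` with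
colour classes `U`, `W`, of density `e(F) / (|U| |W|) > γ` and minimum degree `> m`. -/
structure IsDenseSpot {V : Type*} (G : SimpleGraph V) (m γ : ℝ) (D : BipTriple V) : Prop where
  le : D.F ≤ G
  bipartite : D.F.IsBipartiteWith (D.U : Set V) (D.W : Set V)
  nonempty_left : D.U.Nonempty
  nonempty_right : D.W.Nonempty
  density : γ < (D.F.edgeDensity D.U D.W : ℝ)
  minDegree : ∀ v ∈ D.verts, m < ((D.F.neighborSet v).ncard : ℝ)

/-- `G` is `(m, γ)`-nowhere-dense: it contains no `(m, γ)`-dense spot. -/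
def IsNowhereDenseGraph {V : Type*} (G : SimpleGraph V) (m γ : ℝ) : Prop :=
  ∀ D : BipTriple V, ¬ IsDenseSpot G m γ D

/-- The set `A` is `(Λ, ε, γ, k)`-avoiding with respect to the family `𝒟` of dense spots. -/
def IsAvoiding {V : Type*} (𝒟 : Set (BipTriple V)) (Λ ε γ k : ℝ) (A : Set V) : Prop :=
  (∀ v ∈ A, ∃ D ∈ 𝒟, v ∈ D.verts) ∧
  ∀ X : Set V, (X.ncard : ℝ) ≤ Λ * k →
    (({v | v ∈ A ∧ ¬ ∃ D ∈ 𝒟, v ∈ D.verts ∧ ((X ∩ D.verts).ncard : ℝ) ≤ γ ^ 2 * k}.ncard : ℕ) : ℝ)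
      ≤ ε * k

/-- The tuple `(𝐕, 𝒟, G_reg, G_exp, 𝔄)`. Both `Greg` and `Gexp` are subgraphs with a vertex set
of their own. -/
structure BoundedTuple {V : Type*} (G : SimpleGraph V) where
  clusters : Set (Finset V)
  spots : Set (BipTriple V)
  Greg : G.Subgraph
  Gexp : G.Subgraph
  avoiding : Set V

/-- The union `⋃ 𝐕` of all clusters. -/
def BoundedTuple.clusterUnion {V : Type*} {G : SimpleGraph V} (B : BoundedTuple G) : Set V :=
  {v | ∃ C ∈ B.clusters, v ∈ C}

/-- The edges contained in members of `𝒟`. -/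
def BoundedTuple.spotGraph {V : Type*} {G : SimpleGraph V} (B : BoundedTuple G) : SimpleGraph V :=
  ⨆ D ∈ B.spots, D.F

/-- The edges captured by a bounded decomposition:
`E(G_reg) ∪ E(G_exp) ∪ E_G(𝔄, 𝔄 ∪ ⋃ 𝐕)`. -/
def BoundedTuple.captured {V : Type*} {G : SimpleGraph V} (B : BoundedTuple G) : SimpleGraph V :=
  B.Greg.spanningCoe ⊔ B.Gexp.spanningCoe ⊔ G.between B.avoiding (B.avoiding ∪ B.clusterUnion)

open scoped Classical in
/-- `B` is a `(k, Λ, γ, ε, ν, ρ)`-bounded decomposition of `G` with respect to the vertex partition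
into the (possibly empty) classes `V_j = {v | part v = j}`. The graph `G - G_exp` is obtained from
`G` by deleting the edges of `G_exp`. Dense spots are unoriented, so every condition on `(U, W; F)`
is also imposed on, or also satisfied by, `(W, U; F)`. -/
structure IsBoundedDecomposition {V ι : Type*} (G : SimpleGraph V) (part : V → ι)
    (k Λ γ ε ν ρ : ℝ) (B : BoundedTuple G) : Prop where
  clusters_disjoint : ∀ C ∈ B.clusters, ∀ C' ∈ B.clusters, C ≠ C' → Disjoint C C'
  reg_verts : B.Greg.verts = B.clusterUnion
  reg_le : B.Greg.spanningCoe ≤ G \ B.Gexp.spanningCoe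
  reg_pairs : ∀ x y, B.Greg.Adj x y → ∃ C ∈ B.clusters, ∃ C' ∈ B.clusters,
    C ≠ C' ∧ x ∈ C ∧ y ∈ C' ∧ (∀ u ∈ C, ∀ v ∈ C', G.Adj u v ↔ B.Greg.Adj u v) ∧
    G.IsUniform ε C C' ∧ γ ^ 2 ≤ (G.edgeDensity C C' : ℝ)
  cluster_size : ∀ C ∈ B.clusters, ν * k ≤ (C.card : ℝ) ∧ (C.card : ℝ) ≤ ε * k
  cluster_card_eq : ∀ C ∈ B.clusters, ∀ C' ∈ B.clusters, C.card = C'.card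
  spots_dense : ∀ D ∈ B.spots, IsDenseSpot (G \ B.Gexp.spanningCoe) (γ * k) γ D
  spots_edge_disjoint : ∀ D ∈ B.spots, ∀ D' ∈ B.spots, D ≠ D' → Disjoint D.F D'.F
  spots_cover : ∀ D ∈ B.spots, ∀ u ∈ D.U, ∀ w ∈ D.W, G.Adj u w → B.spotGraph.Adj u w
  reg_in_spot : ∀ C ∈ B.clusters, ∀ C' ∈ B.clusters, (∃ x ∈ C, ∃ y ∈ C', B.Greg.Adj x y) →
    ∃ D ∈ B.spots, (C ⊆ D.U ∧ C' ⊆ D.W) ∨ (C ⊆ D.W ∧ C' ⊆ D.U)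
  cluster_in_part : ∀ C ∈ B.clusters, ∃ j, (∀ v ∈ C, part v = j) ∧
    ((∀ v ∈ C, v ∈ B.Gexp.verts) ∨ (∀ v ∈ C, v ∉ B.Gexp.verts))
  cluster_spot : ∀ C ∈ B.clusters, ∀ D ∈ B.spots,
    (Disjoint C D.U ∨ C ⊆ D.U) ∧ (Disjoint C D.W ∨ C ⊆ D.W)
  exp_nowhereDense : IsNowhereDenseGraph B.Gexp.spanningCoe (γ * k) γ
  exp_minDegree : ∀ v ∈ B.Gexp.verts, ρ * k < ((B.Gexp.neighborSet v).ncard : ℝ)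
  avoiding_disjoint : Disjoint B.avoiding B.clusterUnion
  avoiding_avoids : IsAvoiding B.spots Λ ε γ k B.avoiding

/-- The tuple `(Ψ, 𝐕, 𝒟, G_reg, G_exp, 𝔄)`, the last five entries living in `G - Ψ`. -/
structure SparseTuple {V : Type*} (G : SimpleGraph V) where
  huge : Set V
  rest : BoundedTuple (G.induce hugeᶜ)

/-- The graph spanned by the edges of `⋃ 𝒟`, of `G_exp`, and those incident with `Ψ`. -/
def SparseTuple.degreeGraph {V : Type*} {G : SimpleGraph V} (S : SparseTuple G) : SimpleGraph V :=
  (S.rest.spotGraph ⊔ S.rest.Gexp.spanningCoe).map Subtype.val ⊔ G.between S.huge Set.univ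

/-- The edges captured by a sparse decomposition:
`E(G_reg) ∪ E(G_exp) ∪ E_G(Ψ, V(G)) ∪ E_G(𝔄, 𝔄 ∪ ⋃ 𝐕)`. -/
def SparseTuple.captured {V : Type*} {G : SimpleGraph V} (S : SparseTuple G) : SimpleGraph V :=
  S.rest.captured.map Subtype.val ⊔ G.between S.huge Set.univ

/-- `S` is a `(k, Ω₂, Ω₁, Λ, γ, ε, ν, ρ)`-sparse decomposition of `G` with respect to the vertex
partition into the (possibly empty) classes `{v | part v = j}`. -/
structure IsSparseDecomposition {V ι : Type*} (G : SimpleGraph V) (part : V → ι)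
    (k Ω₂ Ω₁ Λ γ ε ν ρ : ℝ) (S : SparseTuple G) : Prop where
  huge_degree : ∀ v ∈ S.huge, Ω₂ * k ≤ ((G.neighborSet v).ncard : ℝ)
  rest_degree : ∀ v, v ∉ S.huge → ((S.degreeGraph.neighborSet v).ncard : ℝ) ≤ Ω₁ * k
  rest_bounded : IsBoundedDecomposition (G.induce S.hugeᶜ) (fun v => part v.1) k Λ γ ε ν ρ S.rest

/-!
The degrees are handled first. Along the geometric sequence of thresholds `Ω i * k`, some gap
`(Ω i * k, Ω (i + 1) * k)` can be emptied of degrees cheaply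
(`SimpleGraph.exists_degree_gap`): vertices above `Ω i * k` are isolated one after the other as long
as their current degree is at most `Ω (i + 1) * k`, and the sum over `i` of these costs is dominated
by a geometric series at each vertex. The vertices that remain above the gap form `Ψ`, and `G' - Ψ`
has maximum degree at most `Ω i * k`. If the error term is below `e(G) = kn / 2`, then
`ε * Ω i < 1 / 2`, so this degree is at most `k / (2 ε)` and the constants need not depend on `Ω`;
otherwise the empty decomposition suffices.

In a graph `H` of maximum degree `O(k)`, a family of edge-disjoint dense spots covering the maximum
number of edges leaves a nowhere-dense graph (`exists_denseSpot_family`), of which `G_exp` is the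
part that survives the removal of vertices of degree at most `ρ k`. Every vertex lies in boundedly
many spots, and all spots have `O(k)` vertices. Vertices are labelled by the spots that contain
them, on either side, and by their position relative to `G_exp`. The vertices of each label are cut into
clusters of equal size, and an energy increment refines the clusters until, summed over all spots,
the irregular pairs are negligible (`exists_regular_isClustering`). All bounds of this argument are
local, so the cluster size is proportional to `k` although `H` may have many more than `k` vertices.

The vertices of spots outside all clusters form the avoiding set. Few of them carry any given label,
and for a set `X` of `O(k)` vertices only boundedly many spots meet `X` substantially, hence only
boundedly many labels are bad for `X` (`isAvoiding_leftover`). An uncaptured edge in a spot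
therefore joins two clusters that form an irregular or a sparse pair; since `γ * ∑ |U| |W| ≤ e(H)` over all
spots `(U, W; F)`, there are at most `(ε / γ + γ) e(H)` such edges.
-/

/-! ### Isolating vertices of small degree -/

/-- The spanning subgraph of `G` obtained by deleting every edge that meets `S`, so that the
vertices of `S` become isolated. -/
def SimpleGraph.isolate {V : Type*} (G : SimpleGraph V) (S : Finset V) : SimpleGraph V where
  Adj u v := G.Adj u v ∧ u ∉ S ∧ v ∉ S
  symm := ⟨fun _ _ h => ⟨h.1.symm, h.2.2, h.2.1⟩⟩
  loopless := ⟨fun _ h => G.irrefl h.1⟩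

namespace SimpleGraph

section Peeling

open scoped Classical

variable {V : Type*}

lemma isolate_adj {G : SimpleGraph V} {S : Finset V} {u v : V} :
    (G.isolate S).Adj u v ↔ G.Adj u v ∧ u ∉ S ∧ v ∉ S := Iff.rfl

lemma isolate_le (G : SimpleGraph V) (S : Finset V) : G.isolate S ≤ G := fun _ _ h => h.1

variable [Fintype V]

lemma ncard_neighborSet_mono {G H : SimpleGraph V} (h : G ≤ H) (v : V) :
    (G.neighborSet v).ncard ≤ (H.neighborSet v).ncard :=
  Set.ncard_le_ncard (fun _ hw => h hw) (Set.toFinite _)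

lemma ncard_edgeSet_mono {G H : SimpleGraph V} (h : G ≤ H) :
    G.edgeSet.ncard ≤ H.edgeSet.ncard :=
  Set.ncard_le_ncard (edgeSet_mono h) (Set.toFinite _)

lemma ncard_edgeSet_isolate_insert (G : SimpleGraph V) (S : Finset V) (v : V) :
    (G.isolate S).edgeSet.ncard ≤
      (G.isolate (insert v S)).edgeSet.ncard + ((G.isolate S).neighborSet v).ncard := by
  have h1 : (G.isolate S).edgeSet ⊆
      (G.isolate (insert v S)).edgeSet ∪ (G.isolate S).incidenceSet v := by
    intro e he
    induction e using Sym2.ind with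
    | _ x y =>
      by_cases hx : x = v
      · exact Or.inr ⟨he, by simp [hx]⟩
      by_cases hy : y = v
      · exact Or.inr ⟨he, by simp [hy]⟩
      left
      rw [mem_edgeSet, isolate_adj] at he ⊢
      simp only [Finset.mem_insert, not_or]
      exact ⟨he.1, ⟨hx, he.2.1⟩, hy, he.2.2⟩
  have h2 : ((G.isolate S).incidenceSet v).ncard = ((G.isolate S).neighborSet v).ncard :=
    Nat.card_congr ((G.isolate S).incidenceSetEquivNeighborSet v)
  rw [← h2]
  exact (Set.ncard_le_ncard h1 (Set.toFinite _)).trans (Set.ncard_union_le _ _)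

/-- Vertices outside `A` are isolated one after the other as long as their current degree is at
most `τ`. A vertex `v` isolated on the way costs at most `min (deg v) τ` edges. -/
lemma exists_isolate_degree_gt (G : SimpleGraph V) (A : Set V) (τ : ℝ) :
    ∃ S : Finset V, (∀ v ∈ S, v ∉ A) ∧
      (∀ v, v ∉ A → v ∉ S → τ < (((G.isolate S).neighborSet v).ncard : ℝ)) ∧
      (G.edgeSet.ncard : ℝ) ≤ ((G.isolate S).edgeSet.ncard : ℝ) +
        ∑ v ∈ S, min ((G.neighborSet v).ncard : ℝ) τ := by
  let good : Finset V → Prop := fun S => (∀ v ∈ S, v ∉ A) ∧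
    (G.edgeSet.ncard : ℝ) ≤ ((G.isolate S).edgeSet.ncard : ℝ) +
        ∑ v ∈ S, min ((G.neighborSet v).ncard : ℝ) τ
  have h0 : good ∅ := by
    refine ⟨by simp, ?_⟩
    have : G.isolate ∅ = G := by ext u v; simp [isolate_adj]
    simp [this]
  obtain ⟨S, hS, hmax⟩ := Set.Finite.exists_maximal (s := {S | good S}) (Set.toFinite _) ⟨∅, h0⟩
  refine ⟨S, hS.1, fun v hvA hvS => ?_, hS.2⟩
  by_contra! hlt
  have hgood : good (insert v S) := by
    refine ⟨fun w hw => ?_, ?_⟩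
    · rcases Finset.mem_insert.1 hw with rfl | hw
      · exact hvA
      · exact hS.1 w hw
    · rw [Finset.sum_insert hvS]
      have h1 : ((G.isolate S).edgeSet.ncard : ℝ) ≤
        ((G.isolate (insert v S)).edgeSet.ncard : ℝ) +
          (((G.isolate S).neighborSet v).ncard : ℝ) := by
        exact_mod_cast ncard_edgeSet_isolate_insert G S v
      have h2 : (((G.isolate S).neighborSet v).ncard : ℝ) ≤ min ((G.neighborSet v).ncard : ℝ) τ :=
        le_min (by exact_mod_cast ncard_neighborSet_mono (isolate_le G S) v) hlt
      have h3 := hS.2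
      linarith
  exact hvS (hmax hgood (Finset.subset_insert _ _) (Finset.mem_insert_self _ _))

lemma sum_ncard_neighborSet (G : SimpleGraph V) :
    ∑ v, ((G.neighborSet v).ncard : ℝ) = 2 * (G.edgeSet.ncard : ℝ) := by
  have h := G.sum_degrees_eq_twice_card_edges
  have h1 : ∀ v, (G.neighborSet v).ncard = G.degree v := fun v => by
    rw [← card_neighborSet_eq_degree, Set.ncard_eq_toFinset_card', Set.toFinset_card]
  have h2 : G.edgeSet.ncard = G.edgeFinset.card := by
    rw [Set.ncard_eq_toFinset_card', edgeFinset]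
  rw [h2]
  simp_rw [h1]
  exact_mod_cast h

end Peeling

end SimpleGraph

/-! ### A gap in the degree sequence -/

/-- If the thresholds `a` at least double at each step, the truncated values `min d (a (i + 1))`,
taken over the indices `i` with `a i < d`, are dominated by a geometric series. -/
lemma sum_min_le_three_mul {a : ℕ → ℝ} (ha : ∀ i, 1 ≤ i → 0 < a i)
    (ha2 : ∀ i, 1 ≤ i → 2 * a i ≤ a (i + 1)) {d : ℝ} (hd : 0 ≤ d) (t : ℕ) :
    ∑ i ∈ Finset.Icc 1 t, (if a i < d then min d (a (i + 1)) else 0) ≤ 3 * d := by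
  have key : ∑ i ∈ Finset.Icc 1 t, (if a i < d then min d (a (i + 1)) else 0) ≤ 2 * a (t + 1) ∧
      ∑ i ∈ Finset.Icc 1 t, (if a i < d then min d (a (i + 1)) else 0) ≤ 3 * d := by
    induction t with
    | zero => simpa using ⟨(ha 1 le_rfl).le, hd⟩
    | succ t ih =>
      rw [Finset.sum_Icc_succ_top (by omega)]
      have h1 := ha2 (t + 1) (by omega)
      have h2 := ha (t + 1) (by omega)
      split_ifs with h
      · have := min_le_left d (a (t + 1 + 1))
        have := min_le_right d (a (t + 1 + 1))
        constructor <;> linarith [ih.1, ih.2]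
      · constructor <;> linarith [ih.1, ih.2]
  exact key.2

namespace SimpleGraph

section Gap

open scoped Classical

variable {V : Type*} [Fintype V]

/-- Among `s` consecutive intervals between thresholds that at least double, one can be emptied of
degrees by deleting at most `6 e(G) / s` edges. -/
lemma exists_degree_gap (G : SimpleGraph V) {a : ℕ → ℝ} (ha : ∀ i, 1 ≤ i → 0 < a i)
    (ha2 : ∀ i, 1 ≤ i → 2 * a i ≤ a (i + 1)) {s : ℕ} (hs : 1 ≤ s) :
    ∃ i, 1 ≤ i ∧ i ≤ s ∧ ∃ G' ≤ G,
      (∀ v, ((G'.neighborSet v).ncard : ℝ) < a (i + 1) → ((G'.neighborSet v).ncard : ℝ) ≤ a i) ∧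
      s * ((G.edgeSet.ncard : ℝ) - G'.edgeSet.ncard) ≤ 6 * G.edgeSet.ncard := by
  let d : V → ℝ := fun v => ((G.neighborSet v).ncard : ℝ)
  let f : ℕ → ℝ := fun i => ∑ v, if a i < d v then min (d v) (a (i + 1)) else 0
  have hsum : ∑ i ∈ Finset.Icc 1 s, f i ≤ 6 * G.edgeSet.ncard := by
    simp only [f]
    rw [Finset.sum_comm]
    calc _ ≤ ∑ v, 3 * d v := Finset.sum_le_sum fun v _ =>
          sum_min_le_three_mul ha ha2 (Nat.cast_nonneg _) s
      _ = _ := by rw [← Finset.mul_sum, sum_ncard_neighborSet]; ring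
  obtain ⟨i, hi, hfi⟩ : ∃ i ∈ Finset.Icc 1 s, (s : ℝ) * f i ≤ 6 * G.edgeSet.ncard := by
    by_contra! hcon
    have h1 : ∑ i ∈ Finset.Icc 1 s, (6 * G.edgeSet.ncard : ℝ) <
        ∑ i ∈ Finset.Icc 1 s, (s : ℝ) * f i :=
      Finset.sum_lt_sum_of_nonempty ⟨1, by simp [hs]⟩ hcon
    rw [← Finset.mul_sum (Finset.Icc 1 s) f, Finset.sum_const, Nat.card_Icc, nsmul_eq_mul] at h1
    simp only [Nat.add_sub_cancel] at h1
    have := mul_le_mul_of_nonneg_left hsum (Nat.cast_nonneg (α := ℝ) s)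
    linarith
  rw [Finset.mem_Icc] at hi
  obtain ⟨S, hSA, hSdeg, hSe⟩ :=
    exists_isolate_degree_gt G {v | d v ≤ a i} (a (i + 1))
  refine ⟨i, hi.1, hi.2, G.isolate S, isolate_le G S, fun v hv => ?_, ?_⟩
  · by_cases hvA : d v ≤ a i
    · exact le_trans (Nat.cast_le.2 (ncard_neighborSet_mono (isolate_le G S) v)) hvA
    · by_cases hvS : v ∈ S
      · have : (G.isolate S).neighborSet v = ∅ := by
          ext w; simp [isolate_adj, hvS]
        rw [this]
        simpa using (ha i hi.1).le
      · exact absurd (hSdeg v hvA hvS) hv.not_gt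
  · refine le_trans ?_ hfi
    gcongr
    have : ∑ v ∈ S, min (d v) (a (i + 1)) ≤ f i := by
      simp only [f]
      rw [← Finset.sum_filter]
      refine Finset.sum_le_sum_of_subset_of_nonneg (fun v hv => ?_) fun v _ _ =>
        le_min (Nat.cast_nonneg _) (ha _ (by omega)).le
      simpa using hSA v hv
    linarith

end Gap

end SimpleGraph

/-! ### Averages over the cells of a partition -/

section CellAverage

open scoped Classical

variable {α L L' : Type*} [Fintype α]

/-- The conditional expectation of `g` with respect to the partition of `α` into the fibres of
`F`: the average of `g` over the fibre of `F` that contains `p`. -/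
noncomputable def cellAvg (F : α → L) (g : α → ℝ) (p : α) : ℝ :=
  (∑ q with F q = F p, g q) / (Finset.univ.filter fun q => F q = F p).card

lemma cellAvg_congr (F : α → L) (g : α → ℝ) {p q : α} (h : F p = F q) :
    cellAvg F g p = cellAvg F g q := by
  simp only [cellAvg, h]

lemma sum_cellAvg (F : α → L) (g : α → ℝ) {S : Finset α}
    (hS : ∀ p ∈ S, ∀ q, F q = F p → q ∈ S) : ∑ p ∈ S, cellAvg F g p = ∑ p ∈ S, g p := by
  rw [← Finset.sum_fiberwise_of_maps_to (fun p hp => Finset.mem_image_of_mem F hp),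
    ← Finset.sum_fiberwise_of_maps_to (s := S) (fun p hp => Finset.mem_image_of_mem F hp) g]
  refine Finset.sum_congr rfl fun l hl => ?_
  obtain ⟨p, hp, rfl⟩ := Finset.mem_image.1 hl
  have h1 : S.filter (fun q => F q = F p) = Finset.univ.filter fun q => F q = F p := by
    ext q
    simpa using hS p hp q
  rw [h1]
  have h2 : ∀ q ∈ Finset.univ.filter (fun q => F q = F p), cellAvg F g q = cellAvg F g p :=
    fun q hq => cellAvg_congr F g (Finset.mem_filter.1 hq).2
  rw [Finset.sum_congr rfl h2, Finset.sum_const, nsmul_eq_mul, cellAvg]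
  refine mul_div_cancel₀ _ ?_
  have : p ∈ Finset.univ.filter fun q => F q = F p := by simp
  exact_mod_cast (Finset.card_pos.2 ⟨p, this⟩).ne'

lemma cellAvg_nonneg (F : α → L) {g : α → ℝ} (hg : ∀ p, 0 ≤ g p) (p : α) : 0 ≤ cellAvg F g p :=
  div_nonneg (Finset.sum_nonneg fun _ _ => hg _) (Nat.cast_nonneg _)

lemma cellAvg_le_one (F : α → L) {g : α → ℝ} (hg : ∀ p, g p ≤ 1) (p : α) : cellAvg F g p ≤ 1 := by
  refine div_le_one_of_le₀ ?_ (Nat.cast_nonneg _)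
  simpa using Finset.sum_le_card_nsmul (Finset.univ.filter fun q => F q = F p) g 1 fun q _ => hg q

/-- Pythagoras: passing to a finer partition increases the energy by the squared distance between
the two conditional expectations. -/
lemma sum_cellAvg_sub_sq (F : α → L) (F' : α → L') (hF : ∀ p q, F' p = F' q → F p = F q)
    (g : α → ℝ) {S : Finset α} (hS : ∀ p ∈ S, ∀ q, F q = F p → q ∈ S) :
    ∑ p ∈ S, (cellAvg F' g p - cellAvg F g p) ^ 2 =
      ∑ p ∈ S, cellAvg F' g p ^ 2 - ∑ p ∈ S, cellAvg F g p ^ 2 := by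
  have h1 : ∀ p, cellAvg F (fun q => cellAvg F' g q * cellAvg F g q) p = cellAvg F g p ^ 2 := by
    intro p
    have h2 : ∑ q with F q = F p, cellAvg F' g q * cellAvg F g q =
        (∑ q with F q = F p, g q) * cellAvg F g p := by
      rw [← sum_cellAvg F' g (S := Finset.univ.filter fun q => F q = F p), Finset.sum_mul]
      · refine Finset.sum_congr rfl fun q hq => ?_
        rw [cellAvg_congr F g (Finset.mem_filter.1 hq).2]
      · intro q hq r hr
        simp only [Finset.mem_filter, Finset.mem_univ, true_and] at hq ⊢
        exact (hF r q hr).trans hq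
    rw [cellAvg, h2, mul_div_right_comm, sq]
    rfl
  have h3 : ∑ p ∈ S, cellAvg F' g p * cellAvg F g p = ∑ p ∈ S, cellAvg F g p ^ 2 := by
    rw [← sum_cellAvg F _ hS]
    exact Finset.sum_congr rfl fun p _ => h1 p
  have h4 : ∑ p ∈ S, (cellAvg F' g p - cellAvg F g p) ^ 2 = ∑ p ∈ S, cellAvg F' g p ^ 2
      - 2 * ∑ p ∈ S, cellAvg F' g p * cellAvg F g p + ∑ p ∈ S, cellAvg F g p ^ 2 := by
    rw [Finset.mul_sum, ← Finset.sum_sub_distrib, ← Finset.sum_add_distrib]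
    exact Finset.sum_congr rfl fun p _ => by ring
  rw [h4, h3]
  ring

/-- If `g` has average at least `ε` away from `d` on a set `B` that is a union of cells, then so
does its conditional expectation, and Cauchy–Schwarz bounds the squared distance to `d`. -/
lemma mul_card_le_sum_cellAvg_sub_sq (F : α → L) (g : α → ℝ) {B : Finset α}
    (hB : ∀ p ∈ B, ∀ q, F q = F p → q ∈ B) {d ε : ℝ} (hε : 0 ≤ ε)
    (h : ε * B.card ≤ |∑ p ∈ B, g p - d * B.card|) :
    ε ^ 2 * B.card ≤ ∑ p ∈ B, (cellAvg F g p - d) ^ 2 := by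
  rcases B.eq_empty_or_nonempty with rfl | hne
  · simp
  have hpos : (0 : ℝ) < B.card := by exact_mod_cast hne.card_pos
  have h1 := sq_sum_le_card_mul_sum_sq (s := B) (f := fun p => cellAvg F g p - d)
  rw [Finset.sum_sub_distrib, sum_cellAvg F g hB, Finset.sum_const, nsmul_eq_mul] at h1
  have h2 : (ε * B.card) ^ 2 ≤ (∑ p ∈ B, g p - B.card * d) ^ 2 := by
    rw [mul_comm _ d, ← sq_abs (∑ p ∈ B, g p - d * B.card)]
    exact pow_le_pow_left₀ (by positivity) h 2
  refine le_of_mul_le_mul_left ?_ hpos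
  calc _ = (ε * B.card) ^ 2 := by ring
    _ ≤ _ := h2.trans h1

end CellAverage

/-! ### Clusterings -/

section Clustering

open scoped Classical

variable {V L ι : Type*}

/-- `𝒞` is a family of disjoint `c`-element subsets of `S`, on each of which the label `a` is
constant. -/
structure IsClustering (𝒞 : Finset (Finset V)) (S : Finset V) (a : V → L) (c : ℕ) : Prop where
  disjoint : ∀ C ∈ 𝒞, ∀ C' ∈ 𝒞, C ≠ C' → Disjoint C C'
  card_eq : ∀ C ∈ 𝒞, C.card = c
  subset : ∀ C ∈ 𝒞, C ⊆ S
  const : ∀ C ∈ 𝒞, ∀ x ∈ C, ∀ y ∈ C, a x = a y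

/-- The vertices of `S` with label `l` that lie in no member of `𝒞`. -/
noncomputable def leftover (𝒞 : Finset (Finset V)) (S : Finset V) (a : V → L) (l : L) : Finset V :=
  S.filter fun x => a x = l ∧ ∀ C ∈ 𝒞, x ∉ C

lemma mem_leftover {𝒞 : Finset (Finset V)} {S : Finset V} {a : V → L} {l : L} {x : V} :
    x ∈ leftover 𝒞 S a l ↔ x ∈ S ∧ a x = l ∧ ∀ C ∈ 𝒞, x ∉ C := by
  rw [leftover, Finset.mem_filter]

lemma exists_isClustering [Finite V] (S : Finset V) (a : V → L) {c : ℕ} (hc : 0 < c) :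
    ∃ 𝒞, IsClustering 𝒞 S a c ∧ ∀ l, (leftover 𝒞 S a l).card ≤ c := by
  have h0 : IsClustering ∅ S a c := ⟨by simp, by simp, by simp, by simp⟩
  obtain ⟨𝒞, h𝒞, hmax⟩ := Set.Finite.exists_maximal (s := {𝒞 | IsClustering 𝒞 S a c})
    (Set.toFinite _) ⟨∅, h0⟩
  refine ⟨𝒞, h𝒞, fun l => ?_⟩
  by_contra! hlt
  obtain ⟨C, hC, hCc⟩ := Finset.exists_subset_card_eq hlt.le
  have hCd : ∀ C' ∈ 𝒞, Disjoint C C' := fun C' hC' => Finset.disjoint_left.2 fun x hx hx' =>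
    (Finset.mem_filter.1 (hC hx)).2.2 C' hC' hx'
  have hnew : IsClustering (insert C 𝒞) S a c := by
    refine ⟨?_, ?_, ?_, ?_⟩
    · intro A hA B hB hAB
      rcases Finset.mem_insert.1 hA with hA' | hA' <;> rcases Finset.mem_insert.1 hB with hB' | hB'
      · exact absurd (hA'.trans hB'.symm) hAB
      · exact hA' ▸ hCd B hB'
      · exact hB' ▸ (hCd A hA').symm
      · exact h𝒞.disjoint A hA' B hB' hAB
    · intro A hA
      rcases Finset.mem_insert.1 hA with rfl | hA
      exacts [hCc, h𝒞.card_eq A hA]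
    · intro A hA
      rcases Finset.mem_insert.1 hA with rfl | hA
      exacts [fun x hx => (Finset.mem_filter.1 (hC hx)).1, h𝒞.subset A hA]
    · intro A hA
      rcases Finset.mem_insert.1 hA with rfl | hA
      exacts [fun x hx y hy => (Finset.mem_filter.1 (hC hx)).2.1.trans
        (Finset.mem_filter.1 (hC hy)).2.1.symm, h𝒞.const A hA]
  have hCmem : C ∈ 𝒞 := hmax hnew (Finset.subset_insert _ _) (Finset.mem_insert_self _ _)
  obtain ⟨x, hx⟩ := Finset.card_pos.1 (hCc ▸ hc)
  exact Finset.disjoint_left.1 (hCd C hCmem) hx hx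

/-- The cell of `x` in the partition whose cells are the members of `𝒞` and the singletons
outside `⋃ 𝒞`. -/
noncomputable def cellOf (𝒞 : Finset (Finset V)) (x : V) : Finset V :=
  if h : ∃ C ∈ 𝒞, x ∈ C then h.choose else {x}

lemma cellOf_of_mem {𝒞 : Finset (Finset V)}
    (hd : ∀ C ∈ 𝒞, ∀ C' ∈ 𝒞, C ≠ C' → Disjoint C C') {x : V} {C : Finset V} (hC : C ∈ 𝒞)
    (hx : x ∈ C) : cellOf 𝒞 x = C := by
  have h : ∃ C ∈ 𝒞, x ∈ C := ⟨C, hC, hx⟩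
  rw [cellOf, dif_pos h]
  by_contra hne
  exact Finset.disjoint_left.1 (hd _ h.choose_spec.1 _ hC hne) h.choose_spec.2 hx

lemma cellOf_of_notMem {𝒞 : Finset (Finset V)} {x : V} (h : ∀ C ∈ 𝒞, x ∉ C) :
    cellOf 𝒞 x = {x} := by
  rw [cellOf, dif_neg (by push Not; exact h)]

lemma mem_cellOf (𝒞 : Finset (Finset V)) (x : V) : x ∈ cellOf 𝒞 x := by
  by_cases h : ∃ C ∈ 𝒞, x ∈ C
  · rw [cellOf, dif_pos h]
    exact h.choose_spec.2
  · rw [cellOf, dif_neg h]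
    simp

lemma cellOf_eq_or {𝒞 : Finset (Finset V)}
    (hd : ∀ C ∈ 𝒞, ∀ C' ∈ 𝒞, C ≠ C' → Disjoint C C') {x y : V}
    (h : cellOf 𝒞 x = cellOf 𝒞 y) : x = y ∨ ∃ C ∈ 𝒞, x ∈ C ∧ y ∈ C := by
  by_cases hy : ∃ C ∈ 𝒞, y ∈ C
  · obtain ⟨C, hC, hyC⟩ := hy
    rw [cellOf_of_mem hd hC hyC] at h
    exact Or.inr ⟨C, hC, h ▸ mem_cellOf 𝒞 x, hyC⟩
  · push Not at hy
    rw [cellOf_of_notMem hy] at h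
    exact Or.inl (by simpa [h] using mem_cellOf 𝒞 x)

lemma cellOf_eq_iff_mem {𝒞 : Finset (Finset V)}
    (hd : ∀ C ∈ 𝒞, ∀ C' ∈ 𝒞, C ≠ C' → Disjoint C C') {C : Finset V} (hC : C ∈ 𝒞) {x : V} :
    cellOf 𝒞 x = C ↔ x ∈ C :=
  ⟨fun h => h ▸ mem_cellOf 𝒞 x, cellOf_of_mem hd hC⟩

lemma cellOf_eq_of_refines {𝒞 𝒞' : Finset (Finset V)}
    (hd : ∀ C ∈ 𝒞, ∀ C' ∈ 𝒞, C ≠ C' → Disjoint C C')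
    (hd' : ∀ C ∈ 𝒞', ∀ C' ∈ 𝒞', C ≠ C' → Disjoint C C')
    (href : ∀ C' ∈ 𝒞', ∃ C ∈ 𝒞, C' ⊆ C) {x y : V} (h : cellOf 𝒞' x = cellOf 𝒞' y) :
    cellOf 𝒞 x = cellOf 𝒞 y := by
  rcases cellOf_eq_or hd' h with rfl | ⟨C', hC', hx, hy⟩
  · rfl
  · obtain ⟨C, hC, hsub⟩ := href C' hC'
    rw [cellOf_of_mem hd hC (hsub hx), cellOf_of_mem hd hC (hsub hy)]

end Clustering

/-! ### Energy -/

section Energy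

open scoped Classical

variable {V L ι : Type*}

/-- The label on pairs of vertices whose fibres are the products of two cells. -/
noncomputable def cellPair (𝒞 : Finset (Finset V)) (p : V × V) : Finset V × Finset V :=
  (cellOf 𝒞 p.1, cellOf 𝒞 p.2)

/-- The indicator function of adjacency. -/
noncomputable def adjIndicator (G : SimpleGraph V) (p : V × V) : ℝ := if G.Adj p.1 p.2 then 1 else 0

/-- The energy of `𝒞`: the sum, over the pairs `(U D, W D)`, of the squared densities between the
cells that make up `U D` and `W D`, weighted by the sizes of these cells. -/
noncomputable def clusterEnergy [Fintype V] (G : SimpleGraph V) (𝒟 : Finset ι) (U W : ι → Finset V)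
    (𝒞 : Finset (Finset V)) : ℝ :=
  ∑ D ∈ 𝒟, ∑ p ∈ U D ×ˢ W D, cellAvg (cellPair 𝒞) (adjIndicator G) p ^ 2

/-- The pairs of clusters inside `A × B` that are not `ε`-regular. -/
noncomputable def irregularPairs (G : SimpleGraph V) (ε : ℝ) (A B : Finset V)
    (𝒞 : Finset (Finset V)) : Finset (Finset V × Finset V) :=
  (𝒞 ×ˢ 𝒞).filter fun P => P.1 ⊆ A ∧ P.2 ⊆ B ∧ ¬ G.IsUniform ε P.1 P.2

/-- The number of vertex pairs in irregular pairs of clusters, counted once for each pair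
`(U D, W D)` that contains them. -/
noncomputable def irregularMass (G : SimpleGraph V) (ε : ℝ) (𝒟 : Finset ι) (U W : ι → Finset V)
    (𝒞 : Finset (Finset V)) : ℝ :=
  ∑ D ∈ 𝒟, ∑ P ∈ irregularPairs G ε (U D) (W D) 𝒞, (P.1.card : ℝ) * P.2.card

lemma sum_adjIndicator (G : SimpleGraph V) (A B : Finset V) :
    ∑ p ∈ A ×ˢ B, adjIndicator G p = (G.interedges A B).card := by
  simp only [adjIndicator]
  rw [Finset.sum_boole]
  rfl

lemma edgeDensity_mul_card (G : SimpleGraph V) (A B : Finset V) :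
    (G.edgeDensity A B : ℝ) * (A ×ˢ B).card = (G.interedges A B).card := by
  rw [SimpleGraph.edgeDensity_def, Finset.card_product]
  push_cast
  by_cases h : (A.card : ℝ) * B.card = 0
  · have h1 : (G.interedges A B).card ≤ A.card * B.card := G.card_interedges_le_mul A B
    have h2 : A.card * B.card = 0 := by exact_mod_cast h
    rw [h, mul_zero, eq_comm]
    exact_mod_cast Nat.le_zero.1 (h2 ▸ h1)
  · exact div_mul_cancel₀ _ h

lemma saturated_product {𝒞 : Finset (Finset V)}
    (hd : ∀ C ∈ 𝒞, ∀ C' ∈ 𝒞, C ≠ C' → Disjoint C C') {A B : Finset V}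
    (hA : ∀ C ∈ 𝒞, Disjoint C A ∨ C ⊆ A) (hB : ∀ C ∈ 𝒞, Disjoint C B ∨ C ⊆ B) :
    ∀ p ∈ A ×ˢ B, ∀ q, cellPair 𝒞 q = cellPair 𝒞 p → q ∈ A ×ˢ B := by
  have key : ∀ {A : Finset V}, (∀ C ∈ 𝒞, Disjoint C A ∨ C ⊆ A) → ∀ {x y : V}, x ∈ A →
      cellOf 𝒞 y = cellOf 𝒞 x → y ∈ A := by
    intro A hA x y hx hxy
    rcases cellOf_eq_or hd hxy with rfl | ⟨C, hC, hyC, hxC⟩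
    · exact hx
    · rcases hA C hC with h | h
      · exact absurd hx (Finset.disjoint_left.1 h hxC)
      · exact h hyC
  intro p hp q hq
  rw [Finset.mem_product] at hp ⊢
  rw [cellPair, cellPair, Prod.mk.injEq] at hq
  exact ⟨key hA hp.1 hq.1, key hB hp.2 hq.2⟩

variable [Fintype V]

lemma cellAvg_cellPair {𝒞 : Finset (Finset V)}
    (hd : ∀ C ∈ 𝒞, ∀ C' ∈ 𝒞, C ≠ C' → Disjoint C C') (G : SimpleGraph V) {A B : Finset V}
    (hA : A ∈ 𝒞) (hB : B ∈ 𝒞) {p : V × V} (hp : p ∈ A ×ˢ B) :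
    cellAvg (cellPair 𝒞) (adjIndicator G) p = G.edgeDensity A B := by
  rw [Finset.mem_product] at hp
  have h1 : ∀ _ : DecidablePred fun q => cellPair 𝒞 q = cellPair 𝒞 p,
      (Finset.univ.filter fun q => cellPair 𝒞 q = cellPair 𝒞 p) = A ×ˢ B := by
    intro _
    ext q
    simp only [cellPair, cellOf_of_mem hd hA hp.1, cellOf_of_mem hd hB hp.2, Prod.mk.injEq,
      cellOf_eq_iff_mem hd hA, cellOf_eq_iff_mem hd hB, Finset.mem_filter, Finset.mem_univ,
      true_and, Finset.mem_product]
  rw [cellAvg, h1, sum_adjIndicator, ← edgeDensity_mul_card]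
  refine mul_div_cancel_right₀ _ ?_
  exact_mod_cast (Finset.card_pos.2 ⟨p, Finset.mem_product.2 hp⟩).ne'

lemma clusterEnergy_le (G : SimpleGraph V) (𝒟 : Finset ι) (U W : ι → Finset V)
    (𝒞 : Finset (Finset V)) :
    clusterEnergy G 𝒟 U W 𝒞 ≤ ∑ D ∈ 𝒟, ((U D).card : ℝ) * (W D).card := by
  refine Finset.sum_le_sum fun D _ => ?_
  have h : ∀ p ∈ U D ×ˢ W D, cellAvg (cellPair 𝒞) (adjIndicator G) p ^ 2 ≤ 1 := fun p _ =>
    pow_le_one₀ (cellAvg_nonneg _ (fun q => by unfold adjIndicator; split_ifs <;> norm_num) p)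
      (cellAvg_le_one _ (fun q => by unfold adjIndicator; split_ifs <;> norm_num) p)
  have := Finset.sum_le_card_nsmul _ _ _ h
  rw [Finset.card_product] at this
  simpa using this

lemma clusterEnergy_nonneg (G : SimpleGraph V) (𝒟 : Finset ι) (U W : ι → Finset V)
    (𝒞 : Finset (Finset V)) : 0 ≤ clusterEnergy G 𝒟 U W 𝒞 :=
  Finset.sum_nonneg fun _ _ => Finset.sum_nonneg fun _ _ => sq_nonneg _

/-- Refining the clusters by witnesses of irregularity increases the energy inside `A × B`: on the
product of the witnesses of an irregular pair, the new conditional expectation deviates by `ε` on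
average from the old one, which is constant there. -/
lemma sum_irregularPairs_le {𝒞 𝒞' : Finset (Finset V)}
    (hd : ∀ C ∈ 𝒞, ∀ C' ∈ 𝒞, C ≠ C' → Disjoint C C')
    (hd' : ∀ C ∈ 𝒞', ∀ C' ∈ 𝒞', C ≠ C' → Disjoint C C')
    (hne : ∀ C ∈ 𝒞, C.Nonempty)
    (href : ∀ C' ∈ 𝒞', ∃ C ∈ 𝒞, C' ⊆ C) (G : SimpleGraph V) {ε : ℝ} (hε : 0 < ε)
    {A B : Finset V} (hAB : Disjoint A B)
    (hA : ∀ C ∈ 𝒞, Disjoint C A ∨ C ⊆ A) (hB : ∀ C ∈ 𝒞, Disjoint C B ∨ C ⊆ B)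
    (hwit : ∀ P ∈ irregularPairs G ε A B 𝒞, ∀ C' ∈ 𝒞',
      (Disjoint C' (G.nonuniformWitness ε P.1 P.2) ∨ C' ⊆ G.nonuniformWitness ε P.1 P.2) ∧
      (Disjoint C' (G.nonuniformWitness ε P.2 P.1) ∨ C' ⊆ G.nonuniformWitness ε P.2 P.1)) :
    ε ^ 4 * ∑ P ∈ irregularPairs G ε A B 𝒞, (P.1.card : ℝ) * P.2.card ≤
      ∑ p ∈ A ×ˢ B, cellAvg (cellPair 𝒞') (adjIndicator G) p ^ 2 -
        ∑ p ∈ A ×ˢ B, cellAvg (cellPair 𝒞) (adjIndicator G) p ^ 2 := by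
  rw [← sum_cellAvg_sub_sq (cellPair 𝒞) (cellPair 𝒞') _ _ (saturated_product hd hA hB)]
  swap
  · intro p q hpq
    simp only [cellPair, Prod.mk.injEq] at hpq ⊢
    exact ⟨cellOf_eq_of_refines hd hd' href hpq.1, cellOf_eq_of_refines hd hd' href hpq.2⟩
  let Z : Finset V × Finset V → Finset (V × V) := fun P =>
    G.nonuniformWitness ε P.1 P.2 ×ˢ G.nonuniformWitness ε P.2 P.1
  have hirr : ∀ P ∈ irregularPairs G ε A B 𝒞, P.1 ∈ 𝒞 ∧ P.2 ∈ 𝒞 ∧ P.1 ⊆ A ∧ P.2 ⊆ B ∧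
      ¬ G.IsUniform ε P.1 P.2 := by
    intro P hP
    simpa [irregularPairs, and_assoc] using hP
  have hZ : ∀ P ∈ irregularPairs G ε A B 𝒞, Z P ⊆ P.1 ×ˢ P.2 := fun P hP =>
    Finset.product_subset_product (G.nonuniformWitness_subset (hirr P hP).2.2.2.2)
      (G.nonuniformWitness_subset fun h => (hirr P hP).2.2.2.2 h.symm)
  have hZd : Set.PairwiseDisjoint (irregularPairs G ε A B 𝒞 : Set (Finset V × Finset V)) Z := by
    intro P hP Q hQ hPQ
    refine Finset.disjoint_left.2 fun q hqP hqQ => hPQ ?_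
    have h1 := Finset.mem_product.1 (hZ P hP hqP)
    have h2 := Finset.mem_product.1 (hZ Q hQ hqQ)
    exact Prod.ext
      ((cellOf_of_mem hd (hirr P hP).1 h1.1).symm.trans (cellOf_of_mem hd (hirr Q hQ).1 h2.1))
      ((cellOf_of_mem hd (hirr P hP).2.1 h1.2).symm.trans (cellOf_of_mem hd (hirr Q hQ).2.1 h2.2))
  have hZsub : (irregularPairs G ε A B 𝒞).biUnion Z ⊆ A ×ˢ B := by
    refine Finset.biUnion_subset.2 fun P hP => (hZ P hP).trans ?_
    exact Finset.product_subset_product (hirr P hP).2.2.1 (hirr P hP).2.2.2.1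
  refine le_trans ?_ (Finset.sum_le_sum_of_subset_of_nonneg hZsub fun _ _ _ => sq_nonneg _)
  rw [Finset.sum_biUnion hZd, Finset.mul_sum]
  refine Finset.sum_le_sum fun P hP => ?_
  obtain ⟨h1, h2, h3, h4, h5⟩ := hirr P hP
  have hPne : P.1 ≠ P.2 := by
    intro h
    obtain ⟨x, hx⟩ := hne _ h1
    exact Finset.disjoint_left.1 hAB (h3 hx) (h4 (h ▸ hx))
  have hconst : ∀ p ∈ Z P, (cellAvg (cellPair 𝒞') (adjIndicator G) p -
      cellAvg (cellPair 𝒞) (adjIndicator G) p) ^ 2 =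
      (cellAvg (cellPair 𝒞') (adjIndicator G) p - (G.edgeDensity P.1 P.2 : ℝ)) ^ 2 := by
    intro p hp
    rw [cellAvg_cellPair hd G h1 h2 (hZ P hP hp)]
  rw [Finset.sum_congr rfl hconst]
  have hdev : ε * (Z P).card ≤
      |∑ p ∈ Z P, adjIndicator G p - (G.edgeDensity P.1 P.2 : ℝ) * (Z P).card| := by
    rw [sum_adjIndicator, ← edgeDensity_mul_card, ← sub_mul, abs_mul, Nat.abs_cast]
    refine mul_le_mul_of_nonneg_right ?_ (Nat.cast_nonneg _)
    have := G.nonuniformWitness_spec hPne h5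
    exact_mod_cast this
  refine le_trans ?_ (mul_card_le_sum_cellAvg_sub_sq (cellPair 𝒞') (adjIndicator G)
    (saturated_product hd' (fun C' hC' => (hwit P hP C' hC').1)
      (fun C' hC' => (hwit P hP C' hC').2)) hε.le hdev)
  have hc1 := G.le_card_nonuniformWitness h5
  have hc2 := G.le_card_nonuniformWitness fun h => h5 h.symm
  rw [Finset.card_product]
  push_cast
  calc _ = ε ^ 2 * ((P.1.card * ε) * (P.2.card * ε)) := by ring
    _ ≤ _ := by gcongr

end Energy

/-! ### Regularity for locally bounded families -/

section Regularity

open scoped Classical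

/-- The pairs `(U D, W D)` are unions of label classes, and they are locally bounded: a label class
inside `S` has at most `M` vertices, and for each vertex at most `M` vertices lie opposite to it in
one of the pairs. -/
structure IsLocallyBounded {V L ι : Type*} [Fintype V] (𝒟 : Finset ι) (U W : ι → Finset V)
    (S : Finset V) (a : V → L) (M : ℝ) : Prop where
  disjoint : ∀ D ∈ 𝒟, Disjoint (U D) (W D)
  mem_left : ∀ D ∈ 𝒟, ∀ x y, a x = a y → x ∈ U D → y ∈ U D
  mem_right : ∀ D ∈ 𝒟, ∀ x y, a x = a y → x ∈ W D → y ∈ W D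
  card_class : ∀ l, ((S.filter fun x => a x = l).card : ℝ) ≤ M
  card_opposite : ∀ x, ((Finset.univ.filter fun y =>
    ∃ D ∈ 𝒟, (x ∈ U D ∧ y ∈ W D) ∨ (x ∈ W D ∧ y ∈ U D)).card : ℝ) ≤ M

variable {V L ι : Type*}

/-- The clusters that lie opposite to `C` in one of the pairs `(U D, W D)`. -/
noncomputable def oppositeClusters (𝒟 : Finset ι) (U W : ι → Finset V) (𝒞 : Finset (Finset V))
    (C : Finset V) : Finset (Finset V) :=
  𝒞.filter fun C' => ∃ D ∈ 𝒟, (C ⊆ U D ∧ C' ⊆ W D) ∨ (C ⊆ W D ∧ C' ⊆ U D)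

lemma IsClustering.card_mul_le {𝒞 𝒞₀ : Finset (Finset V)} {S : Finset V} {a : V → L} {c : ℕ}
    (h : IsClustering 𝒞 S a c) (h₀ : 𝒞₀ ⊆ 𝒞) {T : Finset V} (hT : ∀ C ∈ 𝒞₀, C ⊆ T) :
    𝒞₀.card * c ≤ T.card := by
  have h1 : (𝒞₀.biUnion id).card = 𝒞₀.card * c := by
    rw [Finset.card_biUnion (t := id)
      fun C hC C' hC' hne => h.disjoint C (h₀ hC) C' (h₀ hC') hne]
    simp only [id]
    rw [Finset.sum_congr rfl fun C hC => h.card_eq C (h₀ hC), Finset.sum_const, smul_eq_mul]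
  rw [← h1]
  exact Finset.card_le_card (Finset.biUnion_subset.2 hT)

lemma IsClustering.nonempty {𝒞 : Finset (Finset V)} {S : Finset V} {a : V → L} {c : ℕ}
    (h : IsClustering 𝒞 S a c) (hc : 0 < c) {C : Finset V} (hC : C ∈ 𝒞) : C.Nonempty :=
  Finset.card_pos.1 (h.card_eq C hC ▸ hc)

lemma IsClustering.disjoint_or_subset {𝒞 : Finset (Finset V)} {S : Finset V} {a : V → L} {c : ℕ}
    (h : IsClustering 𝒞 S a c) {A : Finset V} (hA : ∀ x y, a x = a y → x ∈ A → y ∈ A)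
    {C : Finset V} (hC : C ∈ 𝒞) : Disjoint C A ∨ C ⊆ A := by
  by_cases hd : Disjoint C A
  · exact Or.inl hd
  · obtain ⟨x, hxC, hxA⟩ := Finset.not_disjoint_iff.1 hd
    exact Or.inr fun y hy => hA x y (h.const C hC x hxC y hy) hxA

variable [Fintype V]

/-- One step of the energy increment. The number `p` bounds both the number of clusters in a label
class and the number of clusters opposite to a given one, so that each class splits into at most
`p * 2 ^ p` pieces before these are cut into clusters of size `c'`. -/
lemma IsClustering.exists_refinement {𝒟 : Finset ι} {U W : ι → Finset V} {S : Finset V}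
    {a : V → L} {M : ℝ} (hM : IsLocallyBounded 𝒟 U W S a M) {𝒞 : Finset (Finset V)} {c c' p : ℕ}
    (h : IsClustering 𝒞 S a c) (hc : 0 < c) (hc' : 0 < c') (hp : M ≤ (p * c : ℕ))
    (G : SimpleGraph V) {ε : ℝ} (hε : 0 < ε) :
    ∃ 𝒞', IsClustering 𝒞' S a c' ∧
      (∀ l, (leftover 𝒞' S a l).card ≤ (leftover 𝒞 S a l).card + p * (2 ^ p * c')) ∧
      clusterEnergy G 𝒟 U W 𝒞 + ε ^ 4 * irregularMass G ε 𝒟 U W 𝒞 ≤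
        clusterEnergy G 𝒟 U W 𝒞' := by
  let opp : Finset V → Finset (Finset V) := oppositeClusters 𝒟 U W 𝒞
  have hopp : ∀ C ∈ 𝒞, (opp C).card ≤ p := by
    intro C hC
    obtain ⟨x, hx⟩ := h.nonempty hc hC
    have h1 := h.card_mul_le (𝒞₀ := opp C) (Finset.filter_subset _ _)
      (T := Finset.univ.filter fun y =>
        ∃ D ∈ 𝒟, (x ∈ U D ∧ y ∈ W D) ∨ (x ∈ W D ∧ y ∈ U D)) (by
      intro C' hC' y hy
      obtain ⟨D, hD, hDC⟩ := (Finset.mem_filter.1 hC').2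
      exact Finset.mem_filter.2 ⟨Finset.mem_univ _, D, hD,
        hDC.imp (fun h => ⟨h.1 hx, h.2 hy⟩) fun h => ⟨h.1 hx, h.2 hy⟩⟩)
    have h2 : (((opp C).card * c : ℕ) : ℝ) ≤ (p * c : ℕ) :=
      (Nat.cast_le.2 h1).trans ((hM.card_opposite x).trans hp)
    exact Nat.le_of_mul_le_mul_right (Nat.cast_le.1 h2) hc
  -- The label `w` cuts each cluster along all witnesses of irregularity inside it.
  let w : V → Finset V × Finset (Finset V) := fun x =>
    (cellOf 𝒞 x, (opp (cellOf 𝒞 x)).filter fun C' => x ∈ G.nonuniformWitness ε (cellOf 𝒞 x) C')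
  let T := 𝒞.biUnion id
  obtain ⟨𝒞', h', hleft⟩ := exists_isClustering T w hc'
  have href : ∀ C' ∈ 𝒞', ∃ C ∈ 𝒞, C' ⊆ C := by
    intro C' hC'
    obtain ⟨x, hx⟩ := h'.nonempty hc' hC'
    obtain ⟨C, hC, hxC⟩ := Finset.mem_biUnion.1 (h'.subset C' hC' hx)
    refine ⟨C, hC, fun y hy => ?_⟩
    have h1 : cellOf 𝒞 x = cellOf 𝒞 y := congrArg Prod.fst (h'.const C' hC' x hx y hy)
    rw [cellOf_of_mem h.disjoint hC hxC] at h1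
    exact h1 ▸ mem_cellOf 𝒞 y
  have hwit : ∀ C ∈ 𝒞, ∀ C₂ ∈ opp C, ¬ G.IsUniform ε C C₂ → ∀ C' ∈ 𝒞',
      Disjoint C' (G.nonuniformWitness ε C C₂) ∨ C' ⊆ G.nonuniformWitness ε C C₂ := by
    intro C hC C₂ hC₂ hun C' hC'
    by_cases hd : Disjoint C' (G.nonuniformWitness ε C C₂)
    · exact Or.inl hd
    obtain ⟨x, hxC', hxw⟩ := Finset.not_disjoint_iff.1 hd
    refine Or.inr fun y hy => ?_
    have h1 := h'.const C' hC' x hxC' y hy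
    have hx : cellOf 𝒞 x = C := cellOf_of_mem h.disjoint hC (G.nonuniformWitness_subset hun hxw)
    have hy' : cellOf 𝒞 y = C := (congrArg Prod.fst h1).symm.trans hx
    have h2 := congrArg Prod.snd h1
    simp only [w, hx, hy'] at h2
    have h3 : C₂ ∈ (opp C).filter fun C' => x ∈ G.nonuniformWitness ε C C' :=
      Finset.mem_filter.2 ⟨hC₂, hxw⟩
    rw [h2] at h3
    exact (Finset.mem_filter.1 h3).2
  refine ⟨𝒞', ⟨h'.disjoint, h'.card_eq, ?_, ?_⟩, fun l => ?_, ?_⟩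
  · intro C' hC'
    obtain ⟨C, hC, hsub⟩ := href C' hC'
    exact hsub.trans (h.subset C hC)
  · intro C' hC' x hx y hy
    obtain ⟨C, hC, hsub⟩ := href C' hC'
    exact h.const C hC x (hsub hx) y (hsub hy)
  · let 𝒞l := 𝒞.filter fun C => ∃ x ∈ C, a x = l
    have hl : 𝒞l.card ≤ p := by
      have h1 := h.card_mul_le (𝒞₀ := 𝒞l) (Finset.filter_subset _ _)
        (T := S.filter fun x => a x = l) (by
        intro C hC y hy
        obtain ⟨hC, x, hx, hxl⟩ := Finset.mem_filter.1 hC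
        exact Finset.mem_filter.2 ⟨h.subset C hC hy, (h.const C hC y hy x hx).trans hxl⟩)
      have h2 : ((𝒞l.card * c : ℕ) : ℝ) ≤ (p * c : ℕ) :=
        (Nat.cast_le.2 h1).trans ((hM.card_class l).trans hp)
      exact Nat.le_of_mul_le_mul_right (Nat.cast_le.1 h2) hc
    have hsub : leftover 𝒞' S a l ⊆ leftover 𝒞 S a l ∪
        𝒞l.biUnion fun C => (opp C).powerset.biUnion fun Q => leftover 𝒞' T w (C, Q) := by
      intro x hx
      obtain ⟨hxS, hxl, hx'⟩ := mem_leftover.1 hx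
      by_cases hxT : ∃ C ∈ 𝒞, x ∈ C
      · obtain ⟨C, hC, hxC⟩ := hxT
        refine Finset.mem_union_right _ (Finset.mem_biUnion.2
          ⟨C, Finset.mem_filter.2 ⟨hC, x, hxC, hxl⟩, Finset.mem_biUnion.2 ⟨(w x).2, ?_, ?_⟩⟩)
        · simp only [w, cellOf_of_mem h.disjoint hC hxC]
          exact Finset.mem_powerset.2 (Finset.filter_subset _ _)
        · refine mem_leftover.2 ⟨Finset.mem_biUnion.2 ⟨C, hC, hxC⟩, ?_, hx'⟩
          exact Prod.ext (cellOf_of_mem h.disjoint hC hxC) rfl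
      · push Not at hxT
        exact Finset.mem_union_left _ (mem_leftover.2 ⟨hxS, hxl, hxT⟩)
    refine (Finset.card_le_card hsub).trans ((Finset.card_union_le _ _).trans ?_)
    gcongr
    refine (Finset.card_biUnion_le_card_mul _ _ (2 ^ p * c') fun C hC => ?_).trans (by gcongr)
    refine (Finset.card_biUnion_le_card_mul _ _ c' fun Q _ => hleft _).trans ?_
    rw [Finset.card_powerset]
    gcongr
    · norm_num
    · exact hopp C (Finset.mem_filter.1 hC).1
  · rw [clusterEnergy, clusterEnergy, irregularMass, Finset.mul_sum, ← Finset.sum_add_distrib]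
    refine Finset.sum_le_sum fun D hD => ?_
    have := sum_irregularPairs_le h.disjoint h'.disjoint (fun C hC => h.nonempty hc hC) href G hε
      (hM.disjoint D hD) (fun C hC => h.disjoint_or_subset (hM.mem_left D hD) hC)
      (fun C hC => h.disjoint_or_subset (hM.mem_right D hD) hC) (by
        intro P hP C' hC'
        simp only [irregularPairs, Finset.mem_filter, Finset.mem_product] at hP
        obtain ⟨⟨h1, h2⟩, h3, h4, h5⟩ := hP
        exact ⟨hwit P.1 h1 P.2 (Finset.mem_filter.2 ⟨h2, D, hD, Or.inl ⟨h3, h4⟩⟩) h5 C' hC',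
          hwit P.2 h2 P.1 (Finset.mem_filter.2 ⟨h1, D, hD, Or.inr ⟨h4, h3⟩⟩)
            (fun h => h5 h.symm) C' hC'⟩)
    linarith

end Regularity

section RegularityIteration

open scoped Classical

universe u v w

lemma exists_nat_between {x : ℝ} (hx : 1 ≤ x) : ∃ n : ℕ, 0 < n ∧ x ≤ n ∧ (n : ℝ) ≤ 2 * x := by
  refine ⟨⌈x⌉₊, Nat.ceil_pos.2 (by linarith), Nat.le_ceil x, ?_⟩
  linarith [Nat.ceil_lt_add_one (by linarith : 0 ≤ x)]

/-- After at most `t` energy increments, either the irregular pairs have small total mass or the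
energy has grown by `t ε ^ 5` times its largest possible value. -/
lemma exists_isClustering_energy {ε K β : ℝ} (hε : 0 < ε) (hK : 0 < K) (hβ : 0 < β) (t : ℕ) :
    ∃ ν : ℝ, 0 < ν ∧ ∃ k₀ : ℕ, ∀ (V : Type u) (L : Type v) (ι : Type w) [Fintype V]
      (𝒟 : Finset ι) (U W : ι → Finset V) (S : Finset V) (a : V → L) (G : SimpleGraph V) (k : ℝ),
      (k₀ : ℝ) < k → IsLocallyBounded 𝒟 U W S a (K * k) →
      ∃ c 𝒞, 0 < c ∧ IsClustering 𝒞 S a c ∧ ν * k ≤ c ∧ (c : ℝ) ≤ β * k ∧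
        (∀ l, ((leftover 𝒞 S a l).card : ℝ) ≤ (t + 1) * (β * k)) ∧
        (irregularMass G ε 𝒟 U W 𝒞 ≤ ε * ∑ D ∈ 𝒟, ((U D).card : ℝ) * (W D).card ∨
          t * (ε ^ 5 * ∑ D ∈ 𝒟, ((U D).card : ℝ) * (W D).card) ≤ clusterEnergy G 𝒟 U W 𝒞) := by
  induction t with
  | zero =>
    refine ⟨β / 2, by positivity, ⌈2 / β⌉₊, fun V L ι _ 𝒟 U W S a G k hk hM => ?_⟩
    have hk1 : 2 / β < k := (Nat.le_ceil _).trans_lt hk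
    have hk2 : 1 ≤ β / 2 * k := by
      rw [div_lt_iff₀ hβ] at hk1
      linarith
    obtain ⟨c, hc, hc1, hc2⟩ := exists_nat_between hk2
    obtain ⟨𝒞, h𝒞, hleft⟩ := exists_isClustering S a hc
    have hc3 : (c : ℝ) ≤ β * k := by linarith
    refine ⟨c, 𝒞, hc, h𝒞, hc1, hc3, fun l => ?_, Or.inr ?_⟩
    · have : ((leftover 𝒞 S a l).card : ℝ) ≤ c := by exact_mod_cast hleft l
      simpa using this.trans hc3
    · simpa using clusterEnergy_nonneg G 𝒟 U W 𝒞
  | succ t ih =>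
    obtain ⟨ν, hν, k₀, ih⟩ := ih
    let p : ℕ := ⌈K / ν⌉₊ + 1
    have hp1 : K ≤ p * ν := by
      have : K / ν ≤ p := (Nat.le_ceil _).trans (by simp [p])
      rwa [div_le_iff₀ hν] at this
    have hq : (0 : ℝ) < p * 2 ^ p := by positivity
    have hq1 : (1 : ℝ) ≤ p * 2 ^ p := by
      have h1 : (1 : ℝ) ≤ p := by simp [p]
      have h2 : (1 : ℝ) ≤ 2 ^ p := one_le_pow₀ (by norm_num)
      exact one_le_mul_of_one_le_of_one_le h1 h2
    let ν' := min ν (β / (2 * (p * 2 ^ p)))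
    have hν' : 0 < ν' := lt_min hν (by positivity)
    refine ⟨ν', hν', max k₀ ⌈1 / ν'⌉₊, fun V L ι _ 𝒟 U W S a G k hk hM => ?_⟩
    rw [Nat.cast_max, max_lt_iff] at hk
    have hk0 : 0 < k := lt_of_le_of_lt (Nat.cast_nonneg _) hk.1
    obtain ⟨c, 𝒞, hc, h𝒞, hc1, hc2, hleft, hor⟩ := ih V L ι 𝒟 U W S a G k hk.1 hM
    by_cases hirr : irregularMass G ε 𝒟 U W 𝒞 ≤ ε * ∑ D ∈ 𝒟, ((U D).card : ℝ) * (W D).card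
    · refine ⟨c, 𝒞, hc, h𝒞, le_trans ?_ hc1, hc2, fun l => (hleft l).trans ?_, Or.inl hirr⟩
      · exact mul_le_mul_of_nonneg_right (min_le_left _ _) hk0.le
      · push_cast
        have : 0 < β * k := by positivity
        linarith
    · have hk1 : 1 ≤ ν' * k := by
        have := (Nat.le_ceil (1 / ν')).trans_lt hk.2
        rw [div_lt_iff₀ hν'] at this
        linarith
      obtain ⟨c', hc', hc1', hc2'⟩ := exists_nat_between hk1
      have hpc : K * k ≤ (p * c : ℕ) := by
        push_cast
        calc K * k ≤ p * ν * k := by gcongr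
          _ = p * (ν * k) := by ring
          _ ≤ p * c := by gcongr
      obtain ⟨𝒞', h𝒞', hleft', hE⟩ := h𝒞.exists_refinement hM hc hc' hpc G hε
      have hbound : (p : ℝ) * 2 ^ p * c' ≤ β * k := by
        calc (p : ℝ) * 2 ^ p * c' ≤ p * 2 ^ p * (2 * (β / (2 * (p * 2 ^ p)) * k)) := by
              refine mul_le_mul_of_nonneg_left (hc2'.trans ?_) hq.le
              have : ν' * k ≤ β / (2 * (p * 2 ^ p)) * k :=
                mul_le_mul_of_nonneg_right (min_le_right _ _) hk0.le
              linarith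
          _ = β * k := by
              rw [div_mul_eq_mul_div, ← mul_div_assoc, ← mul_div_assoc,
                div_eq_iff (by positivity)]
              ring
      refine ⟨c', 𝒞', hc', h𝒞', hc1', ?_, fun l => ?_, Or.inr ?_⟩
      · refine le_trans ?_ hbound
        exact le_mul_of_one_le_left (Nat.cast_nonneg _) hq1
      · have h1 : ((leftover 𝒞' S a l).card : ℝ) ≤
            (leftover 𝒞 S a l).card + p * 2 ^ p * c' := by
          have := hleft' l
          rw [← mul_assoc] at this
          exact_mod_cast this
        have h2 := hleft l
        push_cast
        linarith
      · push Not at hirr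
        have h1 := hor.resolve_left hirr.not_ge
        have h2 : ε ^ 4 * (ε * ∑ D ∈ 𝒟, ((U D).card : ℝ) * (W D).card) ≤
            ε ^ 4 * irregularMass G ε 𝒟 U W 𝒞 := by gcongr
        push_cast
        calc _ = t * (ε ^ 5 * ∑ D ∈ 𝒟, ((U D).card : ℝ) * (W D).card) +
              ε ^ 4 * (ε * ∑ D ∈ 𝒟, ((U D).card : ℝ) * (W D).card) := by ring
          _ ≤ _ := by linarith

/-- A regularity lemma for a locally bounded family of pairs. The size of the clusters is a positive
proportion of `k`, however large the order of the graph is compared with `k`. -/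
theorem exists_regular_isClustering {ε K β : ℝ} (hε : 0 < ε) (hK : 0 < K) (hβ : 0 < β) :
    ∃ ν : ℝ, 0 < ν ∧ ∃ k₀ : ℕ, ∀ (V : Type u) (L : Type v) (ι : Type w) [Fintype V]
      (𝒟 : Finset ι) (U W : ι → Finset V) (S : Finset V) (a : V → L) (G : SimpleGraph V) (k : ℝ),
      (k₀ : ℝ) < k → IsLocallyBounded 𝒟 U W S a (K * k) →
      ∃ c 𝒞, 0 < c ∧ IsClustering 𝒞 S a c ∧ ν * k ≤ c ∧ (c : ℝ) ≤ β * k ∧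
        (∀ l, ((leftover 𝒞 S a l).card : ℝ) ≤ β * k) ∧
        irregularMass G ε 𝒟 U W 𝒞 ≤ ε * ∑ D ∈ 𝒟, ((U D).card : ℝ) * (W D).card := by
  obtain ⟨t, ht⟩ : ∃ t : ℕ, 1 ≤ t * ε ^ 5 :=
    ⟨⌈1 / ε ^ 5⌉₊, (div_le_iff₀ (by positivity)).1 (Nat.le_ceil _)⟩
  have ht1 : (0 : ℝ) < t + 1 := by positivity
  obtain ⟨ν, hν, k₀, H⟩ := exists_isClustering_energy.{u, v, w} hε hK
    (div_pos hβ ht1) t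
  refine ⟨ν, hν, k₀, fun V L ι _ 𝒟 U W S a G k hk hM => ?_⟩
  have hk0 : 0 < k := lt_of_le_of_lt (Nat.cast_nonneg _) hk
  obtain ⟨c, 𝒞, hc, h𝒞, hc1, hc2, hleft, hor⟩ := H V L ι 𝒟 U W S a G k hk hM
  refine ⟨c, 𝒞, hc, h𝒞, hc1, hc2.trans ?_, fun l => (hleft l).trans ?_, ?_⟩
  · gcongr
    exact div_le_self hβ.le (by simp)
  · rw [← mul_assoc, mul_div_cancel₀ _ ht1.ne']
  · by_contra! hirr
    have h1 := hor.resolve_left hirr.not_ge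
    -- One more refinement would push the energy above its trivial upper bound.
    obtain ⟨𝒞', -, -, hE⟩ := h𝒞.exists_refinement hM hc one_pos (p := ⌈K * k⌉₊)
      ((Nat.le_ceil _).trans (by exact_mod_cast Nat.le_mul_of_pos_right _ hc)) G hε
    have h2 := clusterEnergy_le G 𝒟 U W 𝒞'
    have h3 : 0 ≤ ∑ D ∈ 𝒟, ((U D).card : ℝ) * (W D).card :=
      Finset.sum_nonneg fun _ _ => by positivity
    have h4 : 0 < ε ^ 4 * irregularMass G ε 𝒟 U W 𝒞 :=
      mul_pos (by positivity) (lt_of_le_of_lt (mul_nonneg hε.le h3) hirr)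
    have h5 := mul_le_mul_of_nonneg_right ht h3
    linarith

end RegularityIteration

/-! ### Dense spots -/

section DenseSpots

open scoped Classical

variable {V : Type*}

instance [Finite V] : Finite (BipTriple V) := by
  refine Finite.of_injective (fun D : BipTriple V => (D.U, D.W, D.F)) fun D D' h => ?_
  cases D
  cases D'
  simpa using h

/-- The graph formed by the edges of all members of `𝒟`. -/
def spotUnion (𝒟 : Set (BipTriple V)) : SimpleGraph V := ⨆ D ∈ 𝒟, D.F

lemma spotUnion_adj {𝒟 : Set (BipTriple V)} {x y : V} :
    (spotUnion 𝒟).Adj x y ↔ ∃ D ∈ 𝒟, D.F.Adj x y := by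
  simp [spotUnion]

variable {G : SimpleGraph V} {m γ : ℝ} {D : BipTriple V}

lemma IsDenseSpot.mono {H : SimpleGraph V} (h : IsDenseSpot G m γ D) (hH : D.F ≤ H) :
    IsDenseSpot H m γ D :=
  ⟨hH, h.bipartite, h.nonempty_left, h.nonempty_right, h.density, h.minDegree⟩

lemma IsDenseSpot.swap (h : IsDenseSpot G m γ D) : IsDenseSpot G m γ ⟨D.W, D.U, D.F⟩ where
  le := h.le
  bipartite := h.bipartite.symm
  nonempty_left := h.nonempty_right
  nonempty_right := h.nonempty_left
  density := by
    simp only [SimpleGraph.edgeDensity_comm _ D.W D.U]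
    exact h.density
  minDegree := fun v hv => h.minDegree v hv.symm

lemma IsDenseSpot.disjoint (h : IsDenseSpot G m γ D) : Disjoint D.U D.W :=
  Finset.disjoint_coe.1 h.bipartite.disjoint

lemma IsDenseSpot.exists_adj (h : IsDenseSpot G m γ D) (hm : 0 ≤ m) : ∃ u w, D.F.Adj u w := by
  obtain ⟨u, hu⟩ := h.nonempty_left
  have h1 := hm.trans_lt (h.minDegree u (Or.inl hu))
  have h2 : (D.F.neighborSet u).Nonempty := by
    rw [Set.nonempty_iff_ne_empty]
    intro h0
    simp [h0] at h1
  exact ⟨u, h2⟩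

lemma IsDenseSpot.mul_card_lt (h : IsDenseSpot G m γ D) :
    γ * (D.U.card * D.W.card) < (D.F.interedges D.U D.W).card := by
  have hU : (0 : ℝ) < D.U.card := by exact_mod_cast h.nonempty_left.card_pos
  have hW : (0 : ℝ) < D.W.card := by exact_mod_cast h.nonempty_right.card_pos
  rw [← edgeDensity_mul_card, Finset.card_product]
  push_cast
  exact mul_lt_mul_of_pos_right h.density (by positivity)

variable [Finite V]

lemma card_interedges_le_sum (F : SimpleGraph V) (A B : Finset V) :
    (F.interedges A B).card ≤ ∑ u ∈ A, (F.neighborSet u).ncard := by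
  rw [Finset.card_eq_sum_card_fiberwise (f := Prod.fst) (t := A)]
  · refine Finset.sum_le_sum fun u _ => ?_
    rw [← Set.ncard_coe_finset]
    refine Set.ncard_le_ncard_of_injOn Prod.snd ?_ ?_ (Set.toFinite _)
    · rintro ⟨x, y⟩ hp
      simp only [Finset.coe_filter, Set.mem_ofPred_eq, SimpleGraph.mk_mem_interedges_iff] at hp
      obtain ⟨⟨-, -, hadj⟩, rfl⟩ := hp
      exact hadj
    · rintro ⟨x, y⟩ hp ⟨x', y'⟩ hp' hyy
      simp only [Finset.coe_filter, Set.mem_ofPred_eq] at hp hp'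
      exact Prod.ext (hp.2.trans hp'.2.symm) hyy
  · intro p hp
    exact ((SimpleGraph.mem_interedges_iff _).1 (Finset.mem_coe.1 hp)).1

lemma IsDenseSpot.card_right_le (h : IsDenseSpot G m γ D) (hγ : 0 < γ) {Δ : ℝ}
    (hΔ : ∀ v, ((G.neighborSet v).ncard : ℝ) ≤ Δ) : (D.W.card : ℝ) ≤ Δ / γ := by
  have hU : (0 : ℝ) < D.U.card := by exact_mod_cast h.nonempty_left.card_pos
  have h1 : ((D.F.interedges D.U D.W).card : ℝ) ≤ ∑ u ∈ D.U, ((D.F.neighborSet u).ncard : ℝ) := by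
    exact_mod_cast card_interedges_le_sum D.F D.U D.W
  have h2 : ∑ u ∈ D.U, ((D.F.neighborSet u).ncard : ℝ) ≤ D.U.card * Δ := by
    have := Fintype.ofFinite V
    rw [← nsmul_eq_mul]
    refine Finset.sum_le_card_nsmul _ _ _ fun u _ => le_trans ?_ (hΔ u)
    exact Nat.cast_le.2 (SimpleGraph.ncard_neighborSet_mono h.le u)
  rw [le_div_iff₀ hγ]
  have h3 := h.mul_card_lt
  refine le_of_mul_le_mul_left ?_ hU
  calc _ = γ * (D.U.card * D.W.card) := by ring
    _ ≤ _ := by linarith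

lemma IsDenseSpot.card_left_le (h : IsDenseSpot G m γ D) (hγ : 0 < γ) {Δ : ℝ}
    (hΔ : ∀ v, ((G.neighborSet v).ncard : ℝ) ≤ Δ) : (D.U.card : ℝ) ≤ Δ / γ :=
  h.swap.card_right_le hγ hΔ

lemma IsDenseSpot.mul_card_le_ncard_edgeSet (h : IsDenseSpot G m γ D) :
    γ * (D.U.card * D.W.card) ≤ D.F.edgeSet.ncard := by
  refine h.mul_card_lt.le.trans (Nat.cast_le.2 ?_)
  rw [← Set.ncard_coe_finset]
  refine Set.ncard_le_ncard_of_injOn (fun p => s(p.1, p.2)) ?_ ?_ (Set.toFinite _)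
  · intro p hp
    exact ((SimpleGraph.mem_interedges_iff _).1 (Finset.mem_coe.1 hp)).2.2
  · intro p hp q hq hpq
    have h1 := (SimpleGraph.mem_interedges_iff _).1 (Finset.mem_coe.1 hp)
    have h2 := (SimpleGraph.mem_interedges_iff _).1 (Finset.mem_coe.1 hq)
    rcases Sym2.eq_iff.1 hpq with h3 | h3
    · exact Prod.ext h3.1 h3.2
    · exact absurd (h3.1 ▸ h1.1) (Finset.disjoint_right.1 h.disjoint h2.2.1)

lemma IsDenseSpot.sup_edge (h : IsDenseSpot G m γ D) {u w : V} (hu : u ∈ D.U)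
    (hw : w ∈ D.W) (huw : G.Adj u w) :
    IsDenseSpot G m γ ⟨D.U, D.W, D.F ⊔ SimpleGraph.edge u w⟩ where
  le := sup_le h.le ((SimpleGraph.edge_le_iff _).2 (Or.inr huw))
  bipartite := by
    refine ⟨h.bipartite.disjoint, fun x y hxy => ?_⟩
    rcases hxy with hxy | hxy
    · exact h.bipartite.mem_of_adj hxy
    · rcases ((SimpleGraph.edge_adj u w x y).1 hxy).1 with ⟨rfl, rfl⟩ | ⟨rfl, rfl⟩
      exacts [Or.inl ⟨hu, hw⟩, Or.inr ⟨hw, hu⟩]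
  nonempty_left := h.nonempty_left
  nonempty_right := h.nonempty_right
  density := by
    refine h.density.trans_le ?_
    rw [Rat.cast_le, SimpleGraph.edgeDensity_def, SimpleGraph.edgeDensity_def]
    refine div_le_div_of_nonneg_right ?_ (by positivity)
    refine Nat.cast_le.2 (Finset.card_le_card fun p hp => ?_)
    rw [SimpleGraph.mem_interedges_iff] at hp ⊢
    exact ⟨hp.1, hp.2.1, Or.inl hp.2.2⟩
  minDegree := fun v hv => (h.minDegree v hv).trans_le (Nat.cast_le.2
    (Set.ncard_le_ncard (fun _ hx => Or.inl hx) (Set.toFinite _)))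

/-- A family of edge-disjoint dense spots that covers as many edges as possible leaves a
nowhere-dense graph, and it covers all edges between the two classes of each of its members, since
an uncovered edge could be added to the spot. -/
lemma exists_denseSpot_family (G : SimpleGraph V) {m : ℝ} (hm : 0 ≤ m) (γ : ℝ) :
    ∃ 𝒟 : Set (BipTriple V), (∀ D ∈ 𝒟, IsDenseSpot G m γ D) ∧
      (∀ D ∈ 𝒟, ∀ D' ∈ 𝒟, D ≠ D' → Disjoint D.F D'.F) ∧
      (∀ D ∈ 𝒟, ∀ u ∈ D.U, ∀ w ∈ D.W, G.Adj u w → (spotUnion 𝒟).Adj u w) ∧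
      IsNowhereDenseGraph (G \ spotUnion 𝒟) m γ := by
  let fam : Set (Set (BipTriple V)) := {𝒟 | (∀ D ∈ 𝒟, IsDenseSpot G m γ D) ∧
      ∀ D ∈ 𝒟, ∀ D' ∈ 𝒟, D ≠ D' → Disjoint D.F D'.F}
  obtain ⟨𝒟, h𝒟, hmax⟩ := Set.exists_max_image fam (fun 𝒟 => (spotUnion 𝒟).edgeSet.ncard)
    (Set.toFinite _) ⟨∅, by simp [fam]⟩
  -- A family that covers all edges covered by `𝒟` covers no others.
  have hno : ∀ 𝒟' ∈ fam, spotUnion 𝒟 ≤ spotUnion 𝒟' → ∀ u w, (spotUnion 𝒟').Adj u w →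
      (spotUnion 𝒟).Adj u w := by
    intro 𝒟' h𝒟' hle u w huw
    have h1 := Set.eq_of_subset_of_ncard_le (SimpleGraph.edgeSet_mono hle) (hmax 𝒟' h𝒟')
      (Set.toFinite _)
    have h2 : s(u, w) ∈ (spotUnion 𝒟').edgeSet := huw
    rwa [← h1] at h2
  have hins : ∀ 𝒟₀ ⊆ 𝒟, ∀ D₁, IsDenseSpot G m γ D₁ → (∀ D ∈ 𝒟₀, Disjoint D.F D₁.F) →
      insert D₁ 𝒟₀ ∈ fam := by
    intro 𝒟₀ h₀ D₁ hD₁ hdis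
    refine ⟨?_, ?_⟩
    · rintro D (rfl | hD)
      exacts [hD₁, h𝒟.1 D (h₀ hD)]
    · rintro D (rfl | hD) D' (rfl | hD') hne
      exacts [absurd rfl hne, (hdis D' hD').symm, hdis D hD, h𝒟.2 D (h₀ hD) D' (h₀ hD') hne]
  refine ⟨𝒟, h𝒟.1, h𝒟.2, fun D hD u hu w hw huw => ?_, fun D hD => ?_⟩
  · by_contra hcon
    let D₁ : BipTriple V := ⟨D.U, D.W, D.F ⊔ SimpleGraph.edge u w⟩
    have hD₁ : IsDenseSpot G m γ D₁ := (h𝒟.1 D hD).sup_edge hu hw huw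
    have hnew : insert D₁ (𝒟 \ {D}) ∈ fam := by
      refine hins _ Set.sdiff_subset D₁ hD₁ fun D' hD' => ?_
      refine disjoint_sup_right.2 ⟨h𝒟.2 D' hD'.1 D hD hD'.2, ?_⟩
      rw [SimpleGraph.disjoint_edge]
      exact fun h => hcon (spotUnion_adj.2 ⟨D', hD'.1, h⟩)
    have hle : spotUnion 𝒟 ≤ spotUnion (insert D₁ (𝒟 \ {D})) := by
      intro x y hxy
      obtain ⟨D', hD', hxy'⟩ := spotUnion_adj.1 hxy
      by_cases hDD : D' = D
      · exact spotUnion_adj.2 ⟨D₁, Set.mem_insert _ _, Or.inl (hDD ▸ hxy')⟩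
      · exact spotUnion_adj.2 ⟨D', Set.mem_insert_of_mem _ ⟨hD', hDD⟩, hxy'⟩
    exact hcon (hno _ hnew hle u w (spotUnion_adj.2 ⟨D₁, Set.mem_insert _ _, Or.inr
      ((SimpleGraph.edge_adj u w u w).2 ⟨Or.inl ⟨rfl, rfl⟩, huw.ne⟩)⟩))
  · obtain ⟨u, w, huw⟩ := hD.exists_adj hm
    have hnot : ∀ D' ∈ 𝒟, Disjoint D'.F D.F := fun D' hD' =>
      Disjoint.mono (fun x y hxy => spotUnion_adj.2 ⟨D', hD', hxy⟩) hD.le disjoint_sdiff_self_right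
    have hnew := hins 𝒟 subset_rfl D (hD.mono (hD.le.trans sdiff_le)) hnot
    have h1 := hno _ hnew (fun x y hxy => by
      obtain ⟨D', hD', hxy'⟩ := spotUnion_adj.1 hxy
      exact spotUnion_adj.2 ⟨D', Set.mem_insert_of_mem _ hD', hxy'⟩) u w
      (spotUnion_adj.2 ⟨D, Set.mem_insert _ _, huw⟩)
    exact (hD.le huw).2 h1

end DenseSpots

section SpotFamily

open scoped Classical

variable {V : Type*} [Fintype V] {G : SimpleGraph V} {m γ Δ : ℝ} {𝒟 : Finset (BipTriple V)}

lemma mul_sum_card_le_ncard_edgeSet (hspot : ∀ D ∈ 𝒟, IsDenseSpot G m γ D)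
    (hdis : ∀ D ∈ 𝒟, ∀ D' ∈ 𝒟, D ≠ D' → Disjoint D.F D'.F) :
    γ * ∑ D ∈ 𝒟, ((D.U.card : ℝ) * D.W.card) ≤ G.edgeSet.ncard := by
  have h1 : ∑ D ∈ 𝒟, D.F.edgeSet.ncard ≤ G.edgeSet.ncard := by
    simp_rw [Set.ncard_eq_toFinset_card']
    rw [← Finset.card_biUnion]
    · refine Finset.card_le_card (Finset.biUnion_subset.2 fun D hD => ?_)
      exact Set.toFinset_mono (SimpleGraph.edgeSet_mono (hspot D hD).le)
    · intro D hD D' hD' hne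
      rw [Function.onFun, Set.disjoint_toFinset, SimpleGraph.disjoint_edgeSet]
      exact hdis D hD D' hD' hne
  rw [Finset.mul_sum]
  exact (Finset.sum_le_sum fun D hD => (hspot D hD).mul_card_le_ncard_edgeSet).trans
    (by exact_mod_cast h1)

lemma mul_card_spots_le (hspot : ∀ D ∈ 𝒟, IsDenseSpot G m γ D)
    (hdis : ∀ D ∈ 𝒟, ∀ D' ∈ 𝒟, D ≠ D' → Disjoint D.F D'.F) (v : V) :
    m * (𝒟.filter fun D => v ∈ D.verts).card ≤ (G.neighborSet v).ncard := by
  have h1 : ∑ D ∈ 𝒟 with v ∈ D.verts, (D.F.neighborSet v).ncard ≤ (G.neighborSet v).ncard := by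
    simp_rw [Set.ncard_eq_toFinset_card']
    rw [← Finset.card_biUnion]
    · refine Finset.card_le_card (Finset.biUnion_subset.2 fun D hD => ?_)
      exact Set.toFinset_mono fun w hw => (hspot D (Finset.mem_filter.1 hD).1).le hw
    · intro D hD D' hD' hne
      rw [Function.onFun, Set.disjoint_toFinset, Set.disjoint_left]
      intro w hw hw'
      have := hdis D (Finset.mem_filter.1 hD).1 D' (Finset.mem_filter.1 hD').1 hne
      rw [← SimpleGraph.disjoint_edgeSet, Set.disjoint_left] at this
      exact this (a := s(v, w)) hw hw'
  have h2 : ∑ D ∈ 𝒟 with v ∈ D.verts, m ≤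
      ∑ D ∈ 𝒟 with v ∈ D.verts, ((D.F.neighborSet v).ncard : ℝ) :=
    Finset.sum_le_sum fun D hD => ((hspot D (Finset.mem_filter.1 hD).1).minDegree v
      (Finset.mem_filter.1 hD).2).le
  rw [Finset.sum_const, nsmul_eq_mul, mul_comm] at h2
  exact h2.trans (by exact_mod_cast h1)

lemma card_opposite_le (hspot : ∀ D ∈ 𝒟, IsDenseSpot G m γ D)
    (hdis : ∀ D ∈ 𝒟, ∀ D' ∈ 𝒟, D ≠ D' → Disjoint D.F D'.F) (hm : 0 < m) (hγ : 0 < γ)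
    (hΔ : ∀ v, ((G.neighborSet v).ncard : ℝ) ≤ Δ) (x : V) :
    ((Finset.univ.filter fun y =>
      ∃ D ∈ 𝒟, (x ∈ D.U ∧ y ∈ D.W) ∨ (x ∈ D.W ∧ y ∈ D.U)).card : ℝ) ≤ Δ / m * (Δ / γ) := by
  have hsub : (Finset.univ.filter fun y =>
      ∃ D ∈ 𝒟, (x ∈ D.U ∧ y ∈ D.W) ∨ (x ∈ D.W ∧ y ∈ D.U)) ⊆
      (𝒟.filter fun D => x ∈ D.verts).biUnion fun D => if x ∈ D.U then D.W else D.U := by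
    intro y hy
    obtain ⟨D, hD, h⟩ := (Finset.mem_filter.1 hy).2
    rw [Finset.mem_biUnion]
    rcases h with h | h
    · exact ⟨D, Finset.mem_filter.2 ⟨hD, Or.inl h.1⟩, by rw [if_pos h.1]; exact h.2⟩
    · refine ⟨D, Finset.mem_filter.2 ⟨hD, Or.inr h.1⟩, ?_⟩
      rw [if_neg (Finset.disjoint_right.1 (hspot D hD).disjoint h.1)]
      exact h.2
  have h1 := (Finset.card_le_card hsub).trans Finset.card_biUnion_le
  have h2 : ∑ D ∈ 𝒟 with x ∈ D.verts, ((if x ∈ D.U then D.W else D.U).card : ℝ) ≤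
      (𝒟.filter fun D => x ∈ D.verts).card * (Δ / γ) := by
    rw [← nsmul_eq_mul]
    refine Finset.sum_le_card_nsmul _ _ _ fun D hD => ?_
    have hD := hspot D (Finset.mem_filter.1 hD).1
    split_ifs
    exacts [hD.card_right_le hγ hΔ, hD.card_left_le hγ hΔ]
  have hΔ0 : 0 ≤ Δ := (Nat.cast_nonneg _).trans (hΔ x)
  have h3 : ((𝒟.filter fun D => x ∈ D.verts).card : ℝ) ≤ Δ / m := by
    rw [le_div_iff₀ hm, mul_comm]
    exact (mul_card_spots_le hspot hdis x).trans (hΔ x)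
  calc _ ≤ ∑ D ∈ 𝒟 with x ∈ D.verts, ((if x ∈ D.U then D.W else D.U).card : ℝ) := by
        exact_mod_cast h1
    _ ≤ _ := h2.trans (by gcongr)

/-- Few members of the family can meet a small set `X` in many vertices, because every vertex lies
in few members. -/
lemma mul_card_spots_inter_le (hspot : ∀ D ∈ 𝒟, IsDenseSpot G m γ D)
    (hdis : ∀ D ∈ 𝒟, ∀ D' ∈ 𝒟, D ≠ D' → Disjoint D.F D'.F) (hm : 0 < m)
    (hΔ : ∀ v, ((G.neighborSet v).ncard : ℝ) ≤ Δ) (X : Set V) (t : ℝ) :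
    (𝒟.filter fun D => t < ((X ∩ D.verts).ncard : ℝ)).card * t ≤ X.ncard * (Δ / m) := by
  calc ((𝒟.filter fun D => t < ((X ∩ D.verts).ncard : ℝ)).card : ℝ) * t
      ≤ ∑ D ∈ 𝒟 with t < ((X ∩ D.verts).ncard : ℝ), ((X ∩ D.verts).ncard : ℝ) := by
        rw [← nsmul_eq_mul]
        exact Finset.card_nsmul_le_sum _ _ _ fun D hD => (Finset.mem_filter.1 hD).2.le
    _ ≤ ∑ D ∈ 𝒟, ((X ∩ D.verts).ncard : ℝ) :=
        Finset.sum_le_sum_of_subset_of_nonneg (Finset.filter_subset _ _) fun _ _ _ =>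
          Nat.cast_nonneg _
    _ = ∑ D ∈ 𝒟, ∑ v ∈ X.toFinset, if v ∈ D.verts then (1 : ℝ) else 0 := by
        refine Finset.sum_congr rfl fun D _ => ?_
        rw [Finset.sum_boole, Set.ncard_eq_toFinset_card']
        congr 2
        ext v
        simp
    _ = ∑ v ∈ X.toFinset, ((𝒟.filter fun D => v ∈ D.verts).card : ℝ) := by
        rw [Finset.sum_comm]
        exact Finset.sum_congr rfl fun v _ => Finset.sum_boole _ _
    _ ≤ X.toFinset.card • (Δ / m) := by
        refine Finset.sum_le_card_nsmul _ _ _ fun v _ => ?_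
        rw [le_div_iff₀ hm, mul_comm]
        exact (mul_card_spots_le hspot hdis v).trans (hΔ v)
    _ = _ := by rw [nsmul_eq_mul, Set.ncard_eq_toFinset_card']

end SpotFamily

/-! ### Lost edges and the avoiding set -/

section UncapturedPairs

open scoped Classical

variable {V ι : Type*}

/-- The edges lost to irregular pairs are bounded by the total size of these pairs, those lost to
pairs of density below `δ` by a `δ`-proportion of the total size of all pairs `(U D, W D)`. -/
lemma ncard_edges_irregular_or_sparse_le [Finite V] {𝒞 : Finset (Finset V)}
    (hd : ∀ C ∈ 𝒞, ∀ C' ∈ 𝒞, C ≠ C' → Disjoint C C') (G : SimpleGraph V) (ε : ℝ) {δ : ℝ}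
    (hδ : 0 ≤ δ) (𝒟 : Finset ι) (U W : ι → Finset V) :
    (({e | ∃ D ∈ 𝒟, ∃ C ∈ 𝒞, ∃ C' ∈ 𝒞, C ⊆ U D ∧ C' ⊆ W D ∧
      (¬ G.IsUniform ε C C' ∨ (G.edgeDensity C C' : ℝ) < δ) ∧
      ∃ u ∈ C, ∃ w ∈ C', G.Adj u w ∧ e = s(u, w)} : Set (Sym2 V)).ncard : ℝ) ≤
      irregularMass G ε 𝒟 U W 𝒞 + δ * ∑ D ∈ 𝒟, ((U D).card : ℝ) * (W D).card := by
  let low : ι → Finset (Finset V × Finset V) := fun D =>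
    (𝒞 ×ˢ 𝒞).filter fun P => P.1 ⊆ U D ∧ P.2 ⊆ W D ∧ (G.edgeDensity P.1 P.2 : ℝ) < δ
  let bad : ι → Finset (V × V) := fun D =>
    (irregularPairs G ε (U D) (W D) 𝒞).biUnion (fun P => P.1 ×ˢ P.2) ∪
      (low D).biUnion fun P => G.interedges P.1 P.2
  have hsub : {e | ∃ D ∈ 𝒟, ∃ C ∈ 𝒞, ∃ C' ∈ 𝒞, C ⊆ U D ∧ C' ⊆ W D ∧
      (¬ G.IsUniform ε C C' ∨ (G.edgeDensity C C' : ℝ) < δ) ∧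
      ∃ u ∈ C, ∃ w ∈ C', G.Adj u w ∧ e = s(u, w)} ⊆
      (((𝒟.biUnion bad).image fun p => s(p.1, p.2) : Finset (Sym2 V)) : Set (Sym2 V)) := by
    rintro e ⟨D, hD, C, hC, C', hC', hCU, hCW, h, u, hu, w, hw, huw, rfl⟩
    rw [Finset.mem_coe, Finset.mem_image]
    refine ⟨(u, w), Finset.mem_biUnion.2 ⟨D, hD, ?_⟩, rfl⟩
    rcases h with h | h
    · exact Finset.mem_union_left _ (Finset.mem_biUnion.2 ⟨(C, C'), Finset.mem_filter.2
        ⟨Finset.mem_product.2 ⟨hC, hC'⟩, hCU, hCW, h⟩, Finset.mem_product.2 ⟨hu, hw⟩⟩)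
    · exact Finset.mem_union_right _ (Finset.mem_biUnion.2 ⟨(C, C'), Finset.mem_filter.2
        ⟨Finset.mem_product.2 ⟨hC, hC'⟩, hCU, hCW, h⟩,
        (SimpleGraph.mem_interedges_iff _).2 ⟨hu, hw, huw⟩⟩)
  have hlow : ∀ D ∈ 𝒟, (((low D).biUnion fun P => G.interedges P.1 P.2).card : ℝ) ≤
      δ * (((U D).card : ℝ) * (W D).card) := by
    intro D _
    have h1 : ∑ P ∈ low D, (P.1 ×ˢ P.2).card ≤ (U D ×ˢ W D).card := by
      rw [← Finset.card_biUnion]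
      · refine Finset.card_le_card (Finset.biUnion_subset.2 fun P hP => ?_)
        obtain ⟨-, h2, h3, -⟩ := Finset.mem_filter.1 hP
        exact Finset.product_subset_product h2 h3
      · intro P hP Q hQ hPQ
        have hP' := Finset.mem_product.1 (Finset.mem_filter.1 hP).1
        have hQ' := Finset.mem_product.1 (Finset.mem_filter.1 hQ).1
        refine Finset.disjoint_left.2 fun q hqP hqQ => hPQ ?_
        have h2 := Finset.mem_product.1 hqP
        have h3 := Finset.mem_product.1 hqQ
        exact Prod.ext
          ((cellOf_of_mem hd hP'.1 h2.1).symm.trans (cellOf_of_mem hd hQ'.1 h3.1))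
          ((cellOf_of_mem hd hP'.2 h2.2).symm.trans (cellOf_of_mem hd hQ'.2 h3.2))
    calc (((low D).biUnion fun P => G.interedges P.1 P.2).card : ℝ)
        ≤ ∑ P ∈ low D, ((G.interedges P.1 P.2).card : ℝ) := by
          exact_mod_cast Finset.card_biUnion_le
      _ ≤ ∑ P ∈ low D, δ * ((P.1 ×ˢ P.2).card : ℝ) := by
          refine Finset.sum_le_sum fun P hP => ?_
          rw [← edgeDensity_mul_card]
          exact mul_le_mul_of_nonneg_right (Finset.mem_filter.1 hP).2.2.2.le (Nat.cast_nonneg _)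
      _ ≤ δ * ((U D ×ˢ W D).card : ℝ) := by
          rw [← Finset.mul_sum]
          exact mul_le_mul_of_nonneg_left (by exact_mod_cast h1) hδ
      _ = _ := by rw [Finset.card_product]; push_cast; rfl
  have hirr : ∀ D ∈ 𝒟,
      (((irregularPairs G ε (U D) (W D) 𝒞).biUnion fun P => P.1 ×ˢ P.2).card : ℝ) ≤
      ∑ P ∈ irregularPairs G ε (U D) (W D) 𝒞, (P.1.card : ℝ) * P.2.card := by
    intro D _
    have := Finset.card_biUnion_le (s := irregularPairs G ε (U D) (W D) 𝒞)
      (t := fun P => P.1 ×ˢ P.2)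
    simp only [Finset.card_product] at this
    exact_mod_cast this
  calc _ ≤ (((𝒟.biUnion bad).image fun p => s(p.1, p.2)).card : ℝ) := by
        rw [← Set.ncard_coe_finset]
        exact Nat.cast_le.2 (Set.ncard_le_ncard hsub (Set.toFinite _))
    _ ≤ ∑ D ∈ 𝒟, ((bad D).card : ℝ) := by
        exact_mod_cast Finset.card_image_le.trans Finset.card_biUnion_le
    _ ≤ ∑ D ∈ 𝒟, (∑ P ∈ irregularPairs G ε (U D) (W D) 𝒞, (P.1.card : ℝ) * P.2.card +
          δ * (((U D).card : ℝ) * (W D).card)) := by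
        refine Finset.sum_le_sum fun D hD => ?_
        refine le_trans ?_ (add_le_add (hirr D hD) (hlow D hD))
        exact_mod_cast Finset.card_union_le _ _
    _ = _ := by rw [Finset.sum_add_distrib, ← Finset.mul_sum]; rfl

end UncapturedPairs

section Avoiding

open scoped Classical

variable {V : Type*}

/-- The label of a vertex `v`: the members of `𝒟` that have `v` in their first and in their second
class, and whether `v` lies in `N`. -/
noncomputable def spotLabel (𝒟 : Finset (BipTriple V)) (N : Finset V) (v : V) :
    Finset (BipTriple V) × Finset (BipTriple V) × Prop :=
  (𝒟.filter fun D => v ∈ D.U, 𝒟.filter fun D => v ∈ D.W, v ∈ N)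

variable [Fintype V]

/-- The vertices that lie in some member of `𝒟`. -/
noncomputable def spotVertices (𝒟 : Finset (BipTriple V)) : Finset V :=
  Finset.univ.filter fun v => ∃ D ∈ 𝒟, v ∈ D.verts

/-- The vertices of dense spots outside all clusters form an avoiding set: given `X`, only boundedly
many spots meet `X` substantially, and a vertex all of whose spots are among these has one of
boundedly many labels. -/
lemma isAvoiding_leftover {G : SimpleGraph V} {𝒟 : Finset (BipTriple V)} {Λ Ω γ ε k β : ℝ}
    (hΛ : 0 < Λ) (hΩ : 0 < Ω) (hγ : 0 < γ) (hk : 0 < k)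
    (hspot : ∀ D ∈ 𝒟, IsDenseSpot G (γ * k) γ D)
    (hdis : ∀ D ∈ 𝒟, ∀ D' ∈ 𝒟, D ≠ D' → Disjoint D.F D'.F)
    (hdeg : ∀ v, ((G.neighborSet v).ncard : ℝ) ≤ Ω * k) {q : ℕ} (hq : Λ * Ω / γ ^ 3 ≤ q)
    (N : Finset V) (𝒞 : Finset (Finset V))
    (hleft : ∀ l, ((leftover 𝒞 (spotVertices 𝒟) (spotLabel 𝒟 N) l).card : ℝ) ≤ β * k)
    (hβ : 2 ^ q * (2 ^ q * 2) * β ≤ ε) :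
    IsAvoiding (𝒟 : Set (BipTriple V)) Λ ε γ k {v | v ∈ spotVertices 𝒟 ∧ ∀ C ∈ 𝒞, v ∉ C} := by
  refine ⟨fun v hv => (Finset.mem_filter.1 hv.1).2, fun X hX => ?_⟩
  let Q := 𝒟.filter fun D => γ ^ 2 * k < ((X ∩ D.verts).ncard : ℝ)
  have hQ : Q.card ≤ q := by
    have h1 := mul_card_spots_inter_le hspot hdis (mul_pos hγ hk) hdeg X (γ ^ 2 * k)
    have h2 : (Q.card : ℝ) * (γ ^ 2 * k) ≤ Λ * k * (Ω / γ) := by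
      refine h1.trans ?_
      rw [mul_div_mul_right _ _ hk.ne']
      gcongr
    have h3 : (Q.card : ℝ) ≤ Λ * Ω / γ ^ 3 := by
      rw [le_div_iff₀ (by positivity)]
      refine le_of_mul_le_mul_right ?_ hk
      calc (Q.card : ℝ) * γ ^ 3 * k = Q.card * (γ ^ 2 * k) * γ := by ring
        _ ≤ Λ * k * (Ω / γ) * γ := by gcongr
        _ = Λ * Ω * k := by field_simp
    exact_mod_cast h3.trans hq
  let labels : Finset (Finset (BipTriple V) × Finset (BipTriple V) × Prop) :=
    Q.powerset ×ˢ Q.powerset ×ˢ Finset.univ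
  have hlabels : labels.card ≤ 2 ^ q * (2 ^ q * 2) := by
    rw [Finset.card_product, Finset.card_product, Finset.card_powerset, Finset.card_univ,
      Fintype.card_prop]
    gcongr <;> norm_num
  have hsub : {v | v ∈ {v | v ∈ spotVertices 𝒟 ∧ ∀ C ∈ 𝒞, v ∉ C} ∧
      ¬ ∃ D ∈ (𝒟 : Set (BipTriple V)), v ∈ D.verts ∧
        ((X ∩ D.verts).ncard : ℝ) ≤ γ ^ 2 * k} ⊆
      ((labels.biUnion (leftover 𝒞 (spotVertices 𝒟) (spotLabel 𝒟 N)) : Finset V) : Set V) := by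
    rintro v ⟨⟨hvS, hvC⟩, hv⟩
    push Not at hv
    rw [Finset.mem_coe, Finset.mem_biUnion]
    refine ⟨spotLabel 𝒟 N v, ?_, mem_leftover.2 ⟨hvS, rfl, hvC⟩⟩
    refine Finset.mem_product.2 ⟨?_, Finset.mem_product.2 ⟨?_, Finset.mem_univ _⟩⟩
    · refine Finset.mem_powerset.2 fun D hD => ?_
      have hD := Finset.mem_filter.1 hD
      exact Finset.mem_filter.2 ⟨hD.1, hv D hD.1 (Or.inl hD.2)⟩
    · refine Finset.mem_powerset.2 fun D hD => ?_
      have hD := Finset.mem_filter.1 hD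
      exact Finset.mem_filter.2 ⟨hD.1, hv D hD.1 (Or.inr hD.2)⟩
  have hβk : 0 ≤ β * k := (Nat.cast_nonneg _).trans (hleft (∅, ∅, True))
  calc _ ≤ ((labels.biUnion (leftover 𝒞 (spotVertices 𝒟) (spotLabel 𝒟 N))).card : ℝ) := by
        rw [← Set.ncard_coe_finset]
        exact Nat.cast_le.2 (Set.ncard_le_ncard hsub (Set.toFinite _))
    _ ≤ ∑ l ∈ labels, ((leftover 𝒞 (spotVertices 𝒟) (spotLabel 𝒟 N) l).card : ℝ) := by
        exact_mod_cast Finset.card_biUnion_le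
    _ ≤ labels.card * (β * k) := by
        rw [← nsmul_eq_mul]
        exact Finset.sum_le_card_nsmul _ _ _ fun l _ => hleft l
    _ ≤ (2 ^ q * (2 ^ q * 2) : ℕ) * (β * k) := by gcongr
    _ = 2 ^ q * (2 ^ q * 2) * β * k := by push_cast; ring
    _ ≤ ε * k := by gcongr

/-- Edge-disjoint dense spots in a graph of bounded degree form a locally bounded family. -/
lemma isLocallyBounded_of_denseSpots {G : SimpleGraph V} {𝒟 : Finset (BipTriple V)} {Ω γ k : ℝ}
    (hΩ : 0 < Ω) (hγ : 0 < γ) (hk : 0 < k)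
    (hspot : ∀ D ∈ 𝒟, IsDenseSpot G (γ * k) γ D)
    (hdis : ∀ D ∈ 𝒟, ∀ D' ∈ 𝒟, D ≠ D' → Disjoint D.F D'.F)
    (hdeg : ∀ v, ((G.neighborSet v).ncard : ℝ) ≤ Ω * k) (N : Finset V) :
    IsLocallyBounded 𝒟 BipTriple.U BipTriple.W (spotVertices 𝒟) (spotLabel 𝒟 N)
      ((Ω / γ + Ω ^ 2 / γ ^ 2) * k) where
  disjoint := fun D hD => (hspot D hD).disjoint
  mem_left := by
    intro D hD x y hxy hx
    have h1 : D ∈ 𝒟.filter fun D => x ∈ D.U := Finset.mem_filter.2 ⟨hD, hx⟩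
    rw [show (𝒟.filter fun D => x ∈ D.U) = 𝒟.filter fun D => y ∈ D.U from
      congrArg Prod.fst hxy] at h1
    exact (Finset.mem_filter.1 h1).2
  mem_right := by
    intro D hD x y hxy hx
    have h1 : D ∈ 𝒟.filter fun D => x ∈ D.W := Finset.mem_filter.2 ⟨hD, hx⟩
    rw [show (𝒟.filter fun D => x ∈ D.W) = 𝒟.filter fun D => y ∈ D.W from
      congrArg (fun l => l.2.1) hxy] at h1
    exact (Finset.mem_filter.1 h1).2
  card_class := by
    intro l
    have hpos : 0 ≤ Ω ^ 2 / γ ^ 2 * k := by positivity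
    have hgoal : Ω * k / γ ≤ (Ω / γ + Ω ^ 2 / γ ^ 2) * k := by
      have : Ω * k / γ = Ω / γ * k := by ring
      linarith
    refine le_trans ?_ hgoal
    have key : ∀ T : Finset V, (∀ x ∈ T, x ∈ spotVertices 𝒟 ∧ spotLabel 𝒟 N x = l) →
        (T.card : ℝ) ≤ Ω * k / γ := by
      intro T hT
      rcases T.eq_empty_or_nonempty with rfl | ⟨x, hx⟩
      · rw [Finset.card_empty, Nat.cast_zero]
        positivity
      obtain ⟨hxS, hxl⟩ := hT x hx
      obtain ⟨D, hD, hxD⟩ := (Finset.mem_filter.1 hxS).2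
      rcases hxD with hxU | hxW
      · refine le_trans (Nat.cast_le.2 (Finset.card_le_card fun y hy => ?_))
          ((hspot D hD).card_left_le hγ hdeg)
        have h1 : D ∈ 𝒟.filter fun D => x ∈ D.U := Finset.mem_filter.2 ⟨hD, hxU⟩
        rw [show (𝒟.filter fun D => x ∈ D.U) = 𝒟.filter fun D => y ∈ D.U from
          congrArg Prod.fst (hxl.trans (hT y hy).2.symm)] at h1
        exact (Finset.mem_filter.1 h1).2
      · refine le_trans (Nat.cast_le.2 (Finset.card_le_card fun y hy => ?_))
          ((hspot D hD).card_right_le hγ hdeg)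
        have h1 : D ∈ 𝒟.filter fun D => x ∈ D.W := Finset.mem_filter.2 ⟨hD, hxW⟩
        rw [show (𝒟.filter fun D => x ∈ D.W) = 𝒟.filter fun D => y ∈ D.W from
          congrArg (fun l => l.2.1) (hxl.trans (hT y hy).2.symm)] at h1
        exact (Finset.mem_filter.1 h1).2
    exact key _ fun x hx => by simpa using hx
  card_opposite := by
    intro x
    refine (card_opposite_le hspot hdis (mul_pos hγ hk) hγ hdeg x).trans ?_
    have h1 : Ω * k / (γ * k) * (Ω * k / γ) = Ω ^ 2 / γ ^ 2 * k := by field_simp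
    have h2 : 0 ≤ Ω / γ * k := by positivity
    rw [h1]
    linarith

end Avoiding

/-! ### Bounded decompositions -/

section BoundedDecomposition

open scoped Classical

universe u

/-- The subgraph formed by the vertices outside `N` and the edges of `F ≤ G` between them. -/
def isolateSubgraph {V : Type*} {G F : SimpleGraph V} (hF : F ≤ G) (N : Finset V) :
    G.Subgraph where
  verts := {v | v ∉ N}
  Adj := (F.isolate N).Adj
  adj_sub := fun h => hF h.1
  edge_vert := fun h => h.2.1
  symm := ⟨fun _ _ h => h.symm⟩

/-- Two clusters whose edges enter `G_reg`: distinct, in opposite classes of a common dense spot,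
`ε`-regular, and of density at least `δ`. -/
def IsRegularPair {V : Type*} (G : SimpleGraph V) (ε δ : ℝ) (𝒟 : Finset (BipTriple V))
    (C C' : Finset V) : Prop :=
  C ≠ C' ∧ (∃ D ∈ 𝒟, (C ⊆ D.U ∧ C' ⊆ D.W) ∨ (C ⊆ D.W ∧ C' ⊆ D.U)) ∧
    G.IsUniform ε C C' ∧ δ ≤ (G.edgeDensity C C' : ℝ)

lemma IsRegularPair.symm {V : Type*} {G : SimpleGraph V} {ε δ : ℝ} {𝒟 : Finset (BipTriple V)}
    {C C' : Finset V} (h : IsRegularPair G ε δ 𝒟 C C') : IsRegularPair G ε δ 𝒟 C' C := by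
  obtain ⟨h1, ⟨D, hD, h2⟩, h3, h4⟩ := h
  exact ⟨h1.symm, ⟨D, hD, h2.symm.imp And.symm And.symm⟩, h3.symm, by
    rwa [SimpleGraph.edgeDensity_comm]⟩

/-- The subgraph on the clusters formed by the edges of `G` in regular pairs. -/
def regularSubgraph {V : Type*} (G : SimpleGraph V) (ε δ : ℝ) (𝒟 : Finset (BipTriple V))
    (𝒞 : Finset (Finset V)) : G.Subgraph where
  verts := {v | ∃ C ∈ 𝒞, v ∈ C}
  Adj x y := G.Adj x y ∧ ∃ C ∈ 𝒞, ∃ C' ∈ 𝒞, x ∈ C ∧ y ∈ C' ∧ IsRegularPair G ε δ 𝒟 C C'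
  adj_sub := fun h => h.1
  edge_vert := fun ⟨_, C, hC, _, _, hx, _⟩ => ⟨C, hC, hx⟩
  symm := ⟨fun _ _ ⟨h, C, hC, C', hC', hx, hy, hreg⟩ =>
    ⟨h.symm, C', hC', C, hC, hy, hx, hreg.symm⟩⟩

/-- A graph of maximum degree at most `Ω k` has a bounded decomposition that captures all edges
except those in irregular or sparse pairs of clusters, and those deleted to make `G_exp` have large
minimum degree. -/
theorem exists_isBoundedDecomposition {Ω Λ γ ε ρ : ℝ} (hΩ : 0 < Ω) (hΛ : 0 < Λ) (hγ : 0 < γ)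
    (hε : 0 < ε) (hρ : 0 < ρ) :
    ∃ ν : ℝ, 0 < ν ∧ ∃ k₀ : ℕ, ∀ (V : Type u) [Fintype V] (G : SimpleGraph V) (k : ℝ),
      (k₀ : ℝ) < k → (∀ v, ((G.neighborSet v).ncard : ℝ) ≤ Ω * k) →
      ∃ B : BoundedTuple G,
        IsBoundedDecomposition G (fun _ => ()) k Λ γ ε ν ρ B ∧
        ((G.edgeSet \ B.captured.edgeSet).ncard : ℝ) ≤
          (ε / γ + γ) * G.edgeSet.ncard + ρ * k * Fintype.card V := by
  let q : ℕ := ⌈Λ * Ω / γ ^ 3⌉₊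
  have hq : Λ * Ω / γ ^ 3 ≤ q := Nat.le_ceil _
  let β : ℝ := ε / (2 ^ q * (2 ^ q * 2))
  have hβ : 0 < β := by positivity
  have hβq : 2 ^ q * (2 ^ q * 2) * β ≤ ε := (mul_div_cancel₀ ε (by positivity)).le
  have hβε : β ≤ ε := by
    refine div_le_self hε.le ?_
    have h1 : (1 : ℝ) ≤ 2 ^ q := one_le_pow₀ (by norm_num)
    nlinarith
  obtain ⟨ν, hν, k₀, hreg⟩ := exists_regular_isClustering.{u, u, u} hε
    (K := Ω / γ + Ω ^ 2 / γ ^ 2) (by positivity) hβ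
  have harith : ∀ x : ℝ, ε * x + γ ^ 2 * x = (ε / γ + γ) * (γ * x) := fun x => by field_simp
  refine ⟨ν, hν, k₀, fun V _ G k hk hdeg => ?_⟩
  have hk0 : 0 < k := lt_of_le_of_lt (Nat.cast_nonneg _) hk
  obtain ⟨𝒟s, hspots, hdiss, hcovers, hnd⟩ := exists_denseSpot_family G (mul_pos hγ hk0).le γ
  obtain ⟨𝒟, rfl⟩ : ∃ 𝒟 : Finset (BipTriple V), (𝒟 : Set (BipTriple V)) = 𝒟s :=
    ⟨(Set.toFinite 𝒟s).toFinset, Set.Finite.coe_toFinset _⟩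
  obtain ⟨N, -, hNdeg, hNe⟩ :=
    (G \ spotUnion (𝒟 : Set (BipTriple V))).exists_isolate_degree_gt ∅ (ρ * k)
  obtain ⟨c, 𝒞, hc, h𝒞, hc1, hc2, hleft, hirr⟩ := hreg V _ _ 𝒟 BipTriple.U BipTriple.W
    (spotVertices 𝒟) (spotLabel 𝒟 N) G k hk
    (isLocallyBounded_of_denseSpots hΩ hγ hk0 hspots hdiss hdeg N)
  have hM := isLocallyBounded_of_denseSpots hΩ hγ hk0 hspots hdiss hdeg N
  let B : BoundedTuple G :=
    { clusters := 𝒞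
      spots := 𝒟
      Greg := regularSubgraph G ε (γ ^ 2) 𝒟 𝒞
      Gexp := isolateSubgraph (sdiff_le : G \ spotUnion (𝒟 : Set (BipTriple V)) ≤ G) N
      avoiding := {v | v ∈ spotVertices 𝒟 ∧ ∀ C ∈ 𝒞, v ∉ C} }
  have hexp : ∀ {x y}, B.Gexp.Adj x y → ¬ (spotUnion (𝒟 : Set (BipTriple V))).Adj x y :=
    fun h => h.1.2
  have hspotcov : ∀ {x y : V} {C C' : Finset V}, x ∈ C → y ∈ C' → G.Adj x y →
      (∃ D ∈ 𝒟, (C ⊆ D.U ∧ C' ⊆ D.W) ∨ (C ⊆ D.W ∧ C' ⊆ D.U)) →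
      (spotUnion (𝒟 : Set (BipTriple V))).Adj x y := by
    rintro x y C C' hx hy hxy ⟨D, hD, h | h⟩
    · exact hcovers D hD x (h.1 hx) y (h.2 hy) hxy
    · exact (hcovers D hD y (h.2 hy) x (h.1 hx) hxy.symm).symm
  refine ⟨B, ?_, ?_⟩
  · refine
      { clusters_disjoint := h𝒞.disjoint
        reg_verts := rfl
        reg_le := ?_
        reg_pairs := ?_
        cluster_size := fun C hC => ?_
        cluster_card_eq := fun C hC C' hC' => (h𝒞.card_eq C hC).trans (h𝒞.card_eq C' hC').symm
        spots_dense := fun D hD => ?_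
        spots_edge_disjoint := hdiss
        spots_cover := hcovers
        reg_in_spot := ?_
        cluster_in_part := fun C hC => ⟨(), fun _ _ => rfl, ?_⟩
        cluster_spot := fun C hC D hD => ⟨h𝒞.disjoint_or_subset (hM.mem_left D hD) hC,
          h𝒞.disjoint_or_subset (hM.mem_right D hD) hC⟩
        exp_nowhereDense := fun D hD => hnd D (hD.mono (hD.le.trans (SimpleGraph.isolate_le _ _)))
        exp_minDegree := fun v hv => hNdeg v (Set.notMem_empty v) hv
        avoiding_disjoint := ?_
        avoiding_avoids := isAvoiding_leftover hΛ hΩ hγ hk0 hspots hdiss hdeg hq N 𝒞 hleft hβq }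
    · rintro x y ⟨hxy, C, hC, C', hC', hx, hy, hr⟩
      exact ⟨hxy, fun h => hexp h (hspotcov hx hy hxy hr.2.1)⟩
    · rintro x y ⟨hxy, C, hC, C', hC', hx, hy, hr⟩
      exact ⟨C, hC, C', hC', hr.1, hx, hy,
        fun u hu v hv => ⟨fun huv => ⟨huv, C, hC, C', hC', hu, hv, hr⟩, fun huv => huv.1⟩,
        hr.2.2.1, hr.2.2.2⟩
    · rw [h𝒞.card_eq C hC]
      exact ⟨hc1, hc2.trans (mul_le_mul_of_nonneg_right hβε hk0.le)⟩
    · refine (hspots D hD).mono fun x y hxy => ⟨(hspots D hD).le hxy, fun h => ?_⟩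
      exact hexp h (spotUnion_adj.2 ⟨D, hD, hxy⟩)
    · rintro C hC C' hC' ⟨x, hx, y, hy, -, C₁, hC₁, C₂, hC₂, hx₁, hy₂, hr⟩
      have h1 : C₁ = C := (cellOf_of_mem h𝒞.disjoint hC₁ hx₁).symm.trans
        (cellOf_of_mem h𝒞.disjoint hC hx)
      have h2 : C₂ = C' := (cellOf_of_mem h𝒞.disjoint hC₂ hy₂).symm.trans
        (cellOf_of_mem h𝒞.disjoint hC' hy)
      subst h1 h2
      exact hr.2.1
    · obtain ⟨x, hx⟩ := h𝒞.nonempty hc hC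
      have hN : ∀ v ∈ C, (v ∈ N ↔ x ∈ N) := fun v hv =>
        iff_of_eq (congrArg (fun l => l.2.2) (h𝒞.const C hC v hv x hx))
      by_cases hxN : x ∈ N
      · exact Or.inr fun v hv h => h ((hN v hv).2 hxN)
      · exact Or.inl fun v hv h => hxN ((hN v hv).1 h)
    · refine Set.disjoint_left.2 ?_
      rintro v hv ⟨C, hC, hvC⟩
      exact hv.2 C hC hvC
  -- An uncaptured edge lies in a dense spot and joins an irregular or sparse pair of clusters, or
  -- it is deleted in the passage from the nowhere-dense graph `F` to `G_exp`.
  · let lost : Set (Sym2 V) := {e | ∃ D ∈ 𝒟, ∃ C ∈ 𝒞, ∃ C' ∈ 𝒞, C ⊆ D.U ∧ C' ⊆ D.W ∧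
      (¬ G.IsUniform ε C C' ∨ (G.edgeDensity C C' : ℝ) < γ ^ 2) ∧
      ∃ u ∈ C, ∃ w ∈ C', G.Adj u w ∧ e = s(u, w)}
    let F := G \ spotUnion (𝒟 : Set (BipTriple V))
    have hlost : ∀ D ∈ 𝒟, ∀ x ∈ D.U, ∀ y ∈ D.W, G.Adj x y → ¬ B.captured.Adj x y →
        s(x, y) ∈ lost := by
      intro D hD x hx y hy hxy hcap
      have hxS : x ∈ spotVertices 𝒟 := Finset.mem_filter.2 ⟨Finset.mem_univ _, D, hD, Or.inl hx⟩
      have hyS : y ∈ spotVertices 𝒟 := Finset.mem_filter.2 ⟨Finset.mem_univ _, D, hD, Or.inr hy⟩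
      have hcover : ∀ v ∈ spotVertices 𝒟, v ∈ B.avoiding ∪ B.clusterUnion := by
        intro v hv
        by_cases hvC : ∃ C ∈ 𝒞, v ∈ C
        · exact Or.inr hvC
        · push Not at hvC
          exact Or.inl ⟨hv, hvC⟩
      rcases hcover x hxS with hxA | ⟨C, hC, hxC⟩
      · exact absurd (Or.inr ⟨hxy, Or.inl ⟨hxA, hcover y hyS⟩⟩) hcap
      rcases hcover y hyS with hyA | ⟨C', hC', hyC'⟩
      · exact absurd (Or.inr ⟨hxy, Or.inr ⟨hcover x hxS, hyA⟩⟩) hcap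
      have hCU : C ⊆ D.U := (h𝒞.disjoint_or_subset (hM.mem_left D hD) hC).resolve_left
        fun h => Finset.disjoint_left.1 h hxC hx
      have hCW : C' ⊆ D.W := (h𝒞.disjoint_or_subset (hM.mem_right D hD) hC').resolve_left
        fun h => Finset.disjoint_left.1 h hyC' hy
      -- The clusters are distinct because the two classes of a dense spot are disjoint.
      have hne : C ≠ C' := by
        rintro rfl
        exact Finset.disjoint_left.1 (hspots D hD).disjoint hx (hCW hxC)
      refine ⟨D, hD, C, hC, C', hC', hCU, hCW, ?_, x, hxC, y, hyC', hxy, rfl⟩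
      by_contra hcon
      push Not at hcon
      exact hcap (Or.inl (Or.inl ⟨hxy, C, hC, C', hC', hxC, hyC', hne,
        ⟨D, hD, Or.inl ⟨hCU, hCW⟩⟩, hcon.1, hcon.2⟩))
    have hsub : G.edgeSet \ B.captured.edgeSet ⊆ lost ∪ (F.edgeSet \ (F.isolate N).edgeSet) := by
      rintro e ⟨heG, hecap⟩
      induction e using Sym2.ind with
      | _ x y =>
        rw [SimpleGraph.mem_edgeSet] at heG hecap
        by_cases hsp : (spotUnion (𝒟 : Set (BipTriple V))).Adj x y
        · left
          obtain ⟨D, hD, hDxy⟩ := spotUnion_adj.1 hsp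
          rcases (hspots D hD).bipartite.mem_of_adj hDxy with h | h
          · exact hlost D hD x h.1 y h.2 heG hecap
          · rw [Sym2.eq_swap]
            exact hlost D hD y h.2 x h.1 heG.symm fun h => hecap h.symm
        · exact Or.inr ⟨⟨heG, hsp⟩, fun h => hecap (Or.inl (Or.inr h))⟩
    have h1 := ncard_edges_irregular_or_sparse_le h𝒞.disjoint G ε (sq_nonneg γ) 𝒟
      BipTriple.U BipTriple.W
    have h2 : ((F.edgeSet \ (F.isolate N).edgeSet).ncard : ℝ) ≤ ρ * k * Fintype.card V := by
      rw [Set.cast_ncard_sdiff (SimpleGraph.edgeSet_mono (SimpleGraph.isolate_le _ _))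
        (Set.toFinite _)]
      have h3 : ∑ v ∈ N, min ((F.neighborSet v).ncard : ℝ) (ρ * k) ≤
          ∑ _v : V, ρ * k := by
        refine (Finset.sum_le_sum fun v _ => min_le_right _ _).trans ?_
        exact Finset.sum_le_sum_of_subset_of_nonneg (Finset.subset_univ _)
          fun _ _ _ => by positivity
      rw [Finset.sum_const, nsmul_eq_mul, Finset.card_univ] at h3
      have h4 : (F.edgeSet.ncard : ℝ) ≤ ((F.isolate N).edgeSet.ncard : ℝ) +
        ∑ v ∈ N, min ((F.neighborSet v).ncard : ℝ) (ρ * k) := hNe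
      linarith
    have h3 := mul_sum_card_le_ncard_edgeSet hspots hdiss
    have h4 : ((G.edgeSet \ B.captured.edgeSet).ncard : ℝ) ≤
        lost.ncard + (F.edgeSet \ (F.isolate N).edgeSet).ncard := by
      exact_mod_cast (Set.ncard_le_ncard hsub (Set.toFinite _)).trans (Set.ncard_union_le _ _)
    have h5 : (lost.ncard : ℝ) ≤ (ε / γ + γ) * G.edgeSet.ncard := by
      refine h1.trans ((add_le_add hirr le_rfl).trans ?_)
      rw [harith]
      exact mul_le_mul_of_nonneg_left h3 (by positivity)
    linarith

end BoundedDecomposition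

/-! ### Sparse decompositions -/

section SparseDecomposition

open scoped Classical

universe u

/-- The tuple all of whose parts are empty. -/
def emptyBoundedTuple {V : Type*} (G : SimpleGraph V) : BoundedTuple G := ⟨∅, ∅, ⊥, ⊥, ∅⟩

lemma isBoundedDecomposition_empty {V : Type*} (G : SimpleGraph V) {k Λ γ ε ν ρ : ℝ} (hk : 0 ≤ k)
    (hγ : 0 ≤ γ) (hε : 0 ≤ ε) :
    IsBoundedDecomposition G (fun _ => ()) k Λ γ ε ν ρ (emptyBoundedTuple G) where
  clusters_disjoint := by simp [emptyBoundedTuple]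
  reg_verts := by simp [emptyBoundedTuple, BoundedTuple.clusterUnion]
  reg_le := by
    intro x y h
    exact h.elim
  reg_pairs := fun x y h => h.elim
  cluster_size := by simp [emptyBoundedTuple]
  cluster_card_eq := by simp [emptyBoundedTuple]
  spots_dense := by simp [emptyBoundedTuple]
  spots_edge_disjoint := by simp [emptyBoundedTuple]
  spots_cover := by simp [emptyBoundedTuple]
  reg_in_spot := by simp [emptyBoundedTuple]
  cluster_in_part := by simp [emptyBoundedTuple]
  cluster_spot := by simp [emptyBoundedTuple]
  exp_nowhereDense := fun D hD => by
    obtain ⟨u, w, huw⟩ := hD.exists_adj (mul_nonneg hγ hk)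
    exact (hD.le huw).elim
  exp_minDegree := fun v hv => hv.elim
  avoiding_disjoint := by simp [emptyBoundedTuple]
  avoiding_avoids := by
    refine ⟨by simp [emptyBoundedTuple], fun X _ => ?_⟩
    simpa [emptyBoundedTuple] using mul_nonneg hε hk

lemma isSparseDecomposition_empty {V : Type*} (G : SimpleGraph V) {k Ω₂ Ω₁ Λ γ ε ν ρ : ℝ}
    (hk : 0 ≤ k) (hΩ : 0 ≤ Ω₁) (hγ : 0 ≤ γ) (hε : 0 ≤ ε) :
    IsSparseDecomposition G (fun _ => ()) k Ω₂ Ω₁ Λ γ ε ν ρ ⟨∅, emptyBoundedTuple _⟩ where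
  huge_degree := fun v hv => hv.elim
  rest_degree := by
    intro v _
    have h : (SparseTuple.degreeGraph (G := G) ⟨∅, emptyBoundedTuple _⟩).neighborSet v = ∅ := by
      ext w
      simp [SparseTuple.degreeGraph, BoundedTuple.spotGraph, emptyBoundedTuple,
        SimpleGraph.between_adj, SimpleGraph.map_adj']
    rw [h]
    simpa using mul_nonneg hΩ hk
  rest_bounded := isBoundedDecomposition_empty _ hk hγ hε

lemma ncard_neighborSet_induce_le {V : Type*} [Finite V] (G : SimpleGraph V) (s : Set V) (v : s) :
    ((G.induce s).neighborSet v).ncard ≤ (G.neighborSet v.1).ncard :=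
  Set.ncard_le_ncard_of_injOn Subtype.val (fun _ hw => hw) Subtype.val_injective.injOn
    (Set.toFinite _)

lemma ncard_edgeSet_induce_le {V : Type*} [Finite V] (G : SimpleGraph V) (s : Set V) :
    (G.induce s).edgeSet.ncard ≤ G.edgeSet.ncard := by
  refine Set.ncard_le_ncard_of_injOn (Sym2.map Subtype.val) (fun e he => ?_)
    (Sym2.map.injective Subtype.val_injective).injOn (Set.toFinite _)
  induction e using Sym2.ind with
  | _ x y => exact he

lemma IsBoundedDecomposition.spotGraph_le {V ι : Type*} {G : SimpleGraph V} {part : V → ι}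
    {k Λ γ ε ν ρ : ℝ} {B : BoundedTuple G} (h : IsBoundedDecomposition G part k Λ γ ε ν ρ B) :
    B.spotGraph ≤ G :=
  iSup₂_le fun D hD => (h.spots_dense D hD).le.trans sdiff_le

lemma map_val_le {V : Type*} {G : SimpleGraph V} {s : Set V} {F : SimpleGraph s}
    (hF : F ≤ G.induce s) : F.map Subtype.val ≤ G := by
  intro x y hxy
  obtain ⟨-, x, y, h, rfl, rfl⟩ := (SimpleGraph.map_adj' _ _ _ _).1 hxy
  exact hF h

/-- If no degree lies strictly between `Ω₁ k` and `Ω₂ k`, then deleting the vertices of high degree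
leaves a graph of bounded degree, and a bounded decomposition of this graph extends to a sparse
decomposition. -/
lemma exists_isSparseDecomposition_of_gap {Ω Λ γ ε ρ : ℝ} (hΩ : 0 < Ω) (hΛ : 0 < Λ) (hγ : 0 < γ)
    (hε : 0 < ε) (hρ : 0 < ρ) :
    ∃ ν : ℝ, 0 < ν ∧ ∃ k₀ : ℕ, ∀ (V : Type u) [Fintype V] (G : SimpleGraph V) (k Ω₁ Ω₂ : ℝ),
      (k₀ : ℝ) < k → Ω₁ ≤ Ω →
      (∀ v, ((G.neighborSet v).ncard : ℝ) < Ω₂ * k → ((G.neighborSet v).ncard : ℝ) ≤ Ω₁ * k) →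
      ∃ S : SparseTuple G,
        IsSparseDecomposition G (fun _ => ()) k Ω₂ Ω₁ Λ γ ε ν ρ S ∧
        ((G.edgeSet \ S.captured.edgeSet).ncard : ℝ) ≤
          (ε / γ + γ) * G.edgeSet.ncard + ρ * k * Fintype.card V := by
  obtain ⟨ν, hν, k₀, H⟩ := exists_isBoundedDecomposition.{u} hΩ hΛ hγ hε hρ
  refine ⟨ν, hν, k₀, fun V _ G k Ω₁ Ω₂ hk hΩ₁ hgap => ?_⟩
  have hk0 : 0 < k := lt_of_le_of_lt (Nat.cast_nonneg _) hk
  let P : Set V := {v | Ω₂ * k ≤ ((G.neighborSet v).ncard : ℝ)}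
  have hP : ∀ v, v ∉ P → ((G.neighborSet v).ncard : ℝ) ≤ Ω₁ * k := fun v hv =>
    hgap v (not_le.1 hv)
  obtain ⟨B, hB, hcap⟩ := H ↥Pᶜ (G.induce Pᶜ) k hk fun v =>
    (Nat.cast_le.2 (ncard_neighborSet_induce_le G Pᶜ v)).trans ((hP v.1 v.2).trans
      (mul_le_mul_of_nonneg_right hΩ₁ hk0.le))
  let S : SparseTuple G := ⟨P, B⟩
  have hle : S.degreeGraph ≤ G :=
    sup_le (map_val_le (sup_le hB.spotGraph_le (SimpleGraph.Subgraph.spanningCoe_le _)))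
      SimpleGraph.between_le
  refine ⟨S, ⟨fun v hv => hv, fun v hv => ?_, hB⟩, ?_⟩
  · exact (Nat.cast_le.2 (SimpleGraph.ncard_neighborSet_mono hle v)).trans (hP v hv)
  · have hsub : G.edgeSet \ S.captured.edgeSet ⊆
        Sym2.map Subtype.val '' ((G.induce Pᶜ).edgeSet \ B.captured.edgeSet) := by
      rintro e ⟨heG, hecap⟩
      induction e using Sym2.ind with
      | _ x y =>
        rw [SimpleGraph.mem_edgeSet] at heG hecap
        have hx : x ∉ P := fun hx => hecap (Or.inr ⟨heG, Or.inl ⟨hx, trivial⟩⟩)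
        have hy : y ∉ P := fun hy => hecap (Or.inr ⟨heG, Or.inr ⟨trivial, hy⟩⟩)
        refine ⟨s(⟨x, hx⟩, ⟨y, hy⟩), ⟨heG, fun h => hecap (Or.inl ?_)⟩, rfl⟩
        exact (SimpleGraph.map_adj' _ _ _ _).2 ⟨heG.ne, ⟨x, hx⟩, ⟨y, hy⟩, h, rfl, rfl⟩
    have h1 : (G.edgeSet \ S.captured.edgeSet).ncard ≤
        ((G.induce Pᶜ).edgeSet \ B.captured.edgeSet).ncard :=
      (Set.ncard_le_ncard hsub (Set.toFinite _)).trans (Set.ncard_image_le (Set.toFinite _))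
    refine (Nat.cast_le.2 h1).trans (hcap.trans ?_)
    gcongr
    · exact ncard_edgeSet_induce_le G Pᶜ
    · exact Fintype.card_subtype_le _

end SparseDecomposition

theorem lemma4p13 (η Λ γ ε ρ : ℝ) (hη : 0 < η) (hη10 : η ≤ 10) (hΛ : 0 < Λ) (hγ : 0 < γ)
    (hε : 0 < ε) (hρ : 0 < ρ) :
    ∃ ν : ℝ, 0 < ν ∧ ∃ k₀ : ℕ,
      ∀ Ω : ℕ → ℝ, (∀ j, 1 ≤ j → 0 < Ω j) → (∀ j, 1 ≤ j → Ω j / Ω (j + 1) ≤ η ^ 2 / 100) →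
      ∀ (V : Type*) [Fintype V] (G : SimpleGraph V) (k : ℝ),
        k = 2 * (G.edgeSet.ncard : ℝ) / (Fintype.card V : ℝ) → (k₀ : ℝ) < k →
        ∃ i : ℕ, 1 ≤ i ∧ (i : ℝ) ≤ 100 / η ^ 2 ∧
          ∃ G' : SimpleGraph V, G' ≤ G ∧
            (G.edgeSet.ncard : ℝ) - (G'.edgeSet.ncard : ℝ) < η * k * (Fintype.card V : ℝ) ∧
            ∃ S : SparseTuple G',
              IsSparseDecomposition G' (fun _ => ()) k (Ω (i + 1)) (Ω i) Λ γ ε ν ρ S ∧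
              ((G.edgeSet \ S.captured.edgeSet).ncard : ℝ) ≤
                (η + 4 * ε / γ + ε * Ω ⌊100 / η ^ 2⌋₊ + γ + ρ) * k * (Fintype.card V : ℝ) := by
  -- If the claimed bound is nontrivial, then `ε Ω i < 1 / 2` for all relevant `i`. This is what
  -- makes it possible to choose `ν` and `k₀` independently of the sequence `Ω`.
  obtain ⟨ν, hν, k₀, H⟩ := exists_isSparseDecomposition_of_gap (Ω := 1 / (2 * ε)) (by positivity)
    hΛ hγ hε hρ
  refine ⟨ν, hν, k₀, fun Ω hΩ hΩr V _ G k hk hk₀ => ?_⟩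
  have hk0 : 0 < k := lt_of_le_of_lt (Nat.cast_nonneg _) hk₀
  have hn : (0 : ℝ) < Fintype.card V := by
    rcases Nat.eq_zero_or_pos (Fintype.card V) with h | h
    · rw [h, Nat.cast_zero, div_zero] at hk
      exact absurd hk hk0.ne'
    · exact_mod_cast h
  have he : k * Fintype.card V = 2 * G.edgeSet.ncard := by
    rw [hk, div_mul_cancel₀ _ hn.ne']
  have hkn : 0 < k * (Fintype.card V : ℝ) := mul_pos hk0 hn
  have hs1 : (1 : ℝ) ≤ 100 / η ^ 2 := by
    rw [le_div_iff₀ (by positivity)]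
    nlinarith
  set s := ⌊100 / η ^ 2⌋₊ with hs
  have hs1' : 1 ≤ s := Nat.le_floor (by exact_mod_cast hs1)
  have hΩs := hΩ s hs1'
  by_cases htriv : 1 / 2 ≤ η + 4 * ε / γ + ε * Ω s + γ + ρ
  · refine ⟨1, le_rfl, by exact_mod_cast hs1, G, le_rfl, ?_, ⟨∅, emptyBoundedTuple _⟩,
      isSparseDecomposition_empty G hk0.le (hΩ 1 le_rfl).le hγ.le hε.le, ?_⟩
    · rw [sub_self]
      positivity
    · have h1 : ((G.edgeSet \ (SparseTuple.captured (G := G)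
          ⟨∅, emptyBoundedTuple _⟩).edgeSet).ncard : ℝ) ≤ G.edgeSet.ncard :=
        Nat.cast_le.2 (Set.ncard_le_ncard Set.sdiff_subset (Set.toFinite _))
      have h2 := mul_le_mul_of_nonneg_right htriv hkn.le
      rw [mul_assoc]
      linarith
  · push Not at htriv
    have hpos1 : 0 < ε / γ := by positivity
    have hdiv : 4 * ε / γ = 4 * (ε / γ) := by ring
    have hpos2 : 0 < ε * Ω s := mul_pos hε hΩs
    rw [hdiv] at htriv ⊢
    have hη2 : η < 1 / 2 := by linarith
    have hstep : ∀ j, 1 ≤ j → 2 * Ω j ≤ Ω (j + 1) := by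
      intro j hj
      have h1 := hΩr j hj
      have h2 := hΩ (j + 1) (by omega)
      rw [div_le_iff₀ h2] at h1
      have h3 : η ^ 2 / 100 ≤ 1 / 2 := by nlinarith
      have h4 := mul_le_mul_of_nonneg_right h3 h2.le
      linarith
    have hmono : ∀ i, 1 ≤ i → ∀ j, i ≤ j → Ω i ≤ Ω j := by
      intro i hi j hij
      induction j, hij using Nat.le_induction with
      | base => exact le_rfl
      | succ j hij ih => linarith [hstep j (hi.trans hij), hΩ j (hi.trans hij)]
    obtain ⟨i, hi1, his, G', hG', hgap, hlost⟩ := G.exists_degree_gap (a := fun i => Ω i * k)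
      (fun i hi => mul_pos (hΩ i hi) hk0)
      (fun i hi => by
        rw [← mul_assoc]
        exact mul_le_mul_of_nonneg_right (hstep i hi) hk0.le) hs1'
    have hΩi : Ω i ≤ 1 / (2 * ε) := by
      rw [le_div_iff₀ (by positivity)]
      have := mul_le_mul_of_nonneg_left (hmono i hi1 s his) hε.le
      linarith
    obtain ⟨S, hS, hcap⟩ := H V G' k (Ω i) (Ω (i + 1)) hk₀ hΩi hgap
    have hsη : 3 < s * η := by
      have h1 : 100 / η ^ 2 < s + 1 := Nat.lt_floor_add_one _
      rw [div_lt_iff₀ (by positivity)] at h1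
      have h2 : (0 : ℝ) ≤ s := Nat.cast_nonneg _
      nlinarith [mul_nonneg (mul_nonneg h2 hη.le) (sub_nonneg.2 hη2.le)]
    have hloss : (G.edgeSet.ncard : ℝ) - G'.edgeSet.ncard < η * k * Fintype.card V := by
      have hs0 : (0 : ℝ) < s := by exact_mod_cast hs1'
      refine lt_of_mul_lt_mul_left (a := (s : ℝ)) ?_ hs0.le
      have h1 := mul_lt_mul_of_pos_right hsη hkn
      calc _ ≤ 6 * (G.edgeSet.ncard : ℝ) := hlost
        _ = 3 * (k * Fintype.card V) := by rw [he]; ring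
        _ < s * η * (k * Fintype.card V) := h1
        _ = _ := by ring
    refine ⟨i, hi1, (Nat.cast_le.2 his).trans (Nat.floor_le (by positivity)), G', hG', hloss,
      S, hS, ?_⟩
    have h1 : ((G.edgeSet \ S.captured.edgeSet).ncard : ℝ) ≤
        (G.edgeSet \ G'.edgeSet).ncard + (G'.edgeSet \ S.captured.edgeSet).ncard := by
      have hsub : G.edgeSet \ S.captured.edgeSet ⊆
          (G.edgeSet \ G'.edgeSet) ∪ (G'.edgeSet \ S.captured.edgeSet) := by
        intro e he
        by_cases h : e ∈ G'.edgeSet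
        exacts [Or.inr ⟨h, he.2⟩, Or.inl ⟨he.1, h⟩]
      exact_mod_cast (Set.ncard_le_ncard hsub (Set.toFinite _)).trans (Set.ncard_union_le _ _)
    rw [Set.cast_ncard_sdiff (SimpleGraph.edgeSet_mono hG') (Set.toFinite _)] at h1
    have h2 : (ε / γ + γ) * G'.edgeSet.ncard ≤ (ε / γ + γ) * (k * Fintype.card V) := by
      refine mul_le_mul_of_nonneg_left ?_ (by positivity)
      have h3 : (G'.edgeSet.ncard : ℝ) ≤ G.edgeSet.ncard :=
        Nat.cast_le.2 (SimpleGraph.ncard_edgeSet_mono hG')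
      have h4 : (0 : ℝ) ≤ G.edgeSet.ncard := Nat.cast_nonneg _
      linarith
    have h5 : 0 ≤ (3 * (ε / γ) + ε * Ω s) * (k * Fintype.card V) := by positivity
    calc ((G.edgeSet \ S.captured.edgeSet).ncard : ℝ)
        ≤ η * k * Fintype.card V + ((ε / γ + γ) * (k * Fintype.card V) +
          ρ * k * Fintype.card V) := by linarith
      _ ≤ η * k * Fintype.card V + ((ε / γ + γ) * (k * Fintype.card V) +
          ρ * k * Fintype.card V) + (3 * (ε / γ) + ε * Ω s) * (k * Fintype.card V) := by linarith
      _ = _ := by ring
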